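/- Let $S$ be a finite set with $|S|\ge 2$ and let $q(x,y)\ge 0$ ($x\ne y$ in $S$) be the jump rates of a continuous time Markov chain on $S$. The noisy voter model with voting mechanism $(S,q)$ is the continuous time Markov chain on $\{0,1\}^S$ in which, from the configuration $\eta$, the state at $x$ flips to $1-\eta(x)$ at rate $$\tfrac12+\sum_{y\ne x}q(x,y)\,\mathbf 1\{\eta(y)\ne\eta(x)\},$$ for each $x \in S$ independently. Let $\mu^\eta_t$ be its law at time $t$ when started from $\eta$. The model has a unique stationary distribution, denoted by $\mu_\infty$. Put $q_{\max}=\max_{x}\sum_{y\ne x}q(x,y)$ and $\rho(q)=\min_{\pi}\frac{\max_x\pi(x)}{\min_x\pi(x)}\in[1,\infty]$, the minimum being over all stationary distributions $\pi$ of $(S,q)$ (a ratio with denominator $0$ is $\infty$). Let $\|m_1-m_2\|_{TV}=\frac12\sum_s|m_1(s)-m_2(s)|$. (i) Let $\alpha\ge1$ and suppose that $t:=\frac12\log|S|-\alpha\ge1$. Let $\mathbf 1$ be the configuration of all ones. Then $$\|\mu^{\mathbf 1}_t-\mu_\infty\|_{TV}\ \ge\ \frac{0.7\,e^{2\alpha}}{16(1+q_{\max})^2\rho(q)^2+0.7\,e^{2\alpha}},$$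 where the right-hand side is read as $0$ if $\rho(q)=\infty$. (ii) Let $\mu^{\eta,H}_t$ be the law at time $t$, started from $\eta$, of the random walk on the hypercube $\{0,1\}^S$ in which each coordinate independently flips at rate $\frac12$ (that is, the noisy voter model with $q\equiv0$). Then for every $t\ge0$, $$\max_{\eta_1,\eta_2\in\{0,1\}^S}\|\mu^{\eta_1}_t-\mu^{\eta_2}_t\|_{TV}\ \le\ \max_{\eta_1,\eta_2\in\{0,1\}^S}\|\mu^{\eta_1,H}_t-\mu^{\eta_2,H}_t\|_{TV}.$$ -/

import Mathlib

namespace NoisyVoter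

noncomputable section

section MarkovChains

variable {Ω : Type*} [Fintype Ω] [DecidableEq Ω]

/-- Generator matrix of the continuous time Markov chain on a finite set which jumps from `x` to
`y ≠ x` at rate `r x y`. The diagonal values `r x x` play no role. -/
def generator (r : Ω → Ω → ℝ) : Matrix Ω Ω ℝ :=
  Matrix.of fun x y => if x = y then -∑ z ∈ Finset.univ.erase x, r x z else r x y

/-- The law at time `t` of the chain with jump rates `r` started from `x`:
the row of index `x` of the transition matrix `exp (t Q)`. -/
def lawAt (r : Ω → Ω → ℝ) (t : ℝ) (x : Ω) : Ω → ℝ :=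
  (NormedSpace.exp (t • generator r) : Matrix Ω Ω ℝ) x

/-- `π` is a stationary distribution of the chain with jump rates `r`:
a probability vector with `π Q = 0`. -/
def IsStationaryDistribution (r : Ω → Ω → ℝ) (π : Ω → ℝ) : Prop :=
  (∀ x, 0 ≤ π x) ∧ ∑ x, π x = 1 ∧ Matrix.vecMul π (generator r) = 0

end MarkovChains

/-- Total variation distance between two probability vectors on a finite set. -/
def tvDist {Ω : Type*} [Fintype Ω] (m₁ m₂ : Ω → ℝ) : ℝ :=
  (1 / 2) * ∑ s, |m₁ s - m₂ s|

/-- The ratio of the largest to the smallest point mass of a probability vector; it is `∞` when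
some point has mass zero. -/
def ratio {S : Type*} (π : S → ℝ) : ENNReal :=
  (⨆ x, ENNReal.ofReal (π x)) / (⨅ x, ENNReal.ofReal (π x))

variable {S : Type*} [Fintype S] [DecidableEq S]

/-- The minimum of `ratio π` over the stationary distributions `π` of the chain `(S, q)`. -/
def rho (q : S → S → ℝ) : ENNReal :=
  ⨅ π : {π : S → ℝ // IsStationaryDistribution q π}, ratio π.1

/-- The maximal rate at which the chain `(S, q)` leaves a state. -/
def qmax (q : S → S → ℝ) : ℝ :=
  ⨆ x, ∑ y ∈ Finset.univ.erase x, q x y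

/-- The configuration `η` with the state at `x` changed. -/
def flip (η : S → Bool) (x : S) : S → Bool :=
  Function.update η x (!η x)

/-- The rate at which the state at `x` changes in configuration `η`: rerandomization contributes
`1 / 2`, and each site `y ≠ x` whose state differs from that of `x` contributes `q x y`. -/
def flipRate (q : S → S → ℝ) (η : S → Bool) (x : S) : ℝ :=
  1 / 2 + ∑ y ∈ Finset.univ.erase x, if η y = η x then 0 else q x y

/-- Jump rates on `{0,1}^S` of the noisy voter model with voting mechanism `(S, q)`. -/
def voterRate (q : S → S → ℝ) (η ζ : S → Bool) : ℝ :=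
  ∑ x, if ζ = flip η x then flipRate q η x else 0

/-- The law at time `t` of the noisy voter model started from the configuration `η`. -/
def voterLaw (q : S → S → ℝ) (t : ℝ) (η : S → Bool) : (S → Bool) → ℝ :=
  lawAt (voterRate q) t η

/-- The law at time `t` of half-speed random walk on the hypercube `{0,1}^S` started from `η`:
the noisy voter model without voting, in which every coordinate independently flips at
rate `1 / 2`. -/
def hypercubeLaw (t : ℝ) (η : S → Bool) : (S → Bool) → ℝ :=
  voterLaw (fun _ _ => 0) t η

end

end NoisyVoter

open Filter Topology

/-! Part (ii) is a comparison of information about the initial configuration. Up to a limit, the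
dynamics alternates symmetric noise of correlation `exp (-(t / n))` with random copying maps `pull
f`. If a site is noised and then copied to several sites, the copies share one noise variable. They
could be simulated from copies made first and noised independently at the same total correlation
(`exists_noise_mul_pull_mul_noise`). Hence all noise can be postponed: the transition is a mixture
of "copy along `f`, add noise of correlation `exp (-t)`, post-process"
(`noise_mul_mem_degradedNoise`). The noise is exactly the hypercube law, copying only changes the
two starting points, and mixing and post-processing do not increase the maximal total variation
distance. Since that bound tends to `0` with the correlation, uniqueness of the stationary law
follows.

Part (i) is a second moment argument. For `π` stationary for `q`, the `π`-weighted magnetization is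
an eigenfunction of the voter generator with eigenvalue `-1`: from all ones its mean is `exp (-t)`,
at stationarity `0`. Its variance is controlled by `(1 + 2 * qmax q) * ∑ x, π x ^ 2`, which is of
order `1 / |S|` when `π` has bounded ratio (`exists_ratio_eq`), and `sq_le_tvDist_mul` turns this
into a distance. -/

/-! ### Product formulas for the exponential -/

theorem norm_pow_sub_pow_le_mul {A : Type*} [NormedRing A] [NormOneClass A] {a b : A} {L : ℝ}
    (hL : 1 ≤ L) (ha : ‖a‖ ≤ L) (hb : ‖b‖ ≤ L) (n : ℕ) :
    ‖a ^ n - b ^ n‖ ≤ n * L ^ n * ‖a - b‖ := by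
  induction n with
  | zero => simp
  | succ n ih =>
    have h : a ^ (n + 1) - b ^ (n + 1) = a ^ n * (a - b) + (a ^ n - b ^ n) * b := by
      rw [pow_succ, pow_succ]; noncomm_ring
    have h1 : ‖a ^ n‖ ≤ L ^ n := (norm_pow_le a n).trans (by gcongr)
    have h2 : L ^ n ≤ L ^ (n + 1) := pow_le_pow_right₀ hL (Nat.le_succ n)
    calc ‖a ^ (n + 1) - b ^ (n + 1)‖
        ≤ ‖a ^ n‖ * ‖a - b‖ + ‖a ^ n - b ^ n‖ * ‖b‖ := by
          rw [h]
          exact (norm_add_le _ _).trans (add_le_add (norm_mul_le _ _) (norm_mul_le _ _))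
      _ ≤ L ^ (n + 1) * ‖a - b‖ + (n * L ^ n * ‖a - b‖) * L := by
          gcongr
          exact h1.trans h2
      _ = ↑(n + 1) * L ^ (n + 1) * ‖a - b‖ := by push_cast; ring

/-- **Chernoff's product formula** in a Banach algebra. -/
theorem HasDerivAt.tendsto_pow_exp {A : Type*} [NormedRing A] [NormedAlgebra ℝ A]
    [NormOneClass A] [CompleteSpace A] {F : ℝ → A} {G : A} (hF : HasDerivAt F G 0)
    (hF0 : F 0 = 1) (t : ℝ) :
    Tendsto (fun n : ℕ => F (t / n) ^ n) atTop (𝓝 (NormedSpace.exp (t • G))) := by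
  have hE : HasDerivAt (fun h : ℝ => NormedSpace.exp (h • G)) G 0 := by
    simpa using hasDerivAt_exp_smul_const (𝕂 := ℝ) G (0 : ℝ)
  have hlim : Tendsto (fun n : ℕ => t / (n : ℝ)) atTop (𝓝 0) :=
    tendsto_const_div_atTop_nhds_zero_nat t
  -- This form of the bound keeps the `n`-th power below `exp ((‖G‖ + 1) * |t|)`, uniformly in `n`.
  have bound : ∀ {f : ℝ → A}, HasDerivAt f G 0 → f 0 = 1 →
      ∀ᶠ n : ℕ in atTop, ‖f (t / n)‖ ≤ Real.exp ((‖G‖ + 1) * |t / n|) := by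
    intro f hf h0
    have h1 := (hasDerivAt_iff_isLittleO.1 hf).def one_pos
    filter_upwards [hlim.eventually h1] with n hn
    simp only [sub_zero, h0, one_mul, Real.norm_eq_abs] at hn
    have h2 : ‖(t / (n : ℝ)) • G‖ = |t / n| * ‖G‖ := by rw [norm_smul, Real.norm_eq_abs]
    have h3 : f (t / n) = (f (t / n) - 1 - (t / (n : ℝ)) • G) + (1 + (t / (n : ℝ)) • G) := by abel
    have h4 : ‖f (t / n)‖ ≤ |t / n| + (1 + |t / n| * ‖G‖) := by
      rw [h3, ← h2]
      refine (norm_add_le _ _).trans (add_le_add hn ((norm_add_le _ _).trans ?_))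
      simp
    have h5 := Real.add_one_le_exp ((‖G‖ + 1) * |t / n|)
    nlinarith
  have hdiff : Tendsto (fun n : ℕ => (n : ℝ) * ‖F (t / n) - NormedSpace.exp ((t / (n : ℝ)) • G)‖)
      atTop (𝓝 0) := by
    have h1 := (hasDerivAt_iff_isLittleO.1 (hF.sub hE))
    simp only [Pi.sub_apply, hF0, zero_smul, NormedSpace.exp_zero, sub_self, sub_zero, smul_zero]
      at h1
    have h2 := (h1.comp_tendsto hlim).norm_norm
    have h3 : (fun n : ℕ => (n : ℝ) * ‖F (t / n) - NormedSpace.exp ((t / (n : ℝ)) • G)‖)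
        =o[atTop] (fun n : ℕ => (n : ℝ) * ‖t / (n : ℝ)‖) :=
      (Asymptotics.isBigO_refl _ _).mul_isLittleO h2
    have h4 : (fun n : ℕ => (n : ℝ) * ‖t / (n : ℝ)‖) =O[atTop] (fun _ => (1 : ℝ)) := by
      refine Asymptotics.IsBigO.of_bound |t| (eventually_atTop.2 ⟨1, fun n hn => ?_⟩)
      have : (0 : ℝ) < n := by exact_mod_cast hn
      simp only [Real.norm_eq_abs, norm_mul, abs_div, abs_abs, Nat.abs_cast, abs_one, mul_one]
      field_simp
      exact le_rfl
    exact (Asymptotics.isLittleO_one_iff ℝ).1 (h3.trans_isBigO h4)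
  have key : Tendsto (fun n : ℕ => F (t / n) ^ n - NormedSpace.exp ((t / (n : ℝ)) • G) ^ n)
      atTop (𝓝 0) := by
    have hlim0 := hdiff.const_mul (Real.exp ((‖G‖ + 1) * |t|))
    rw [mul_zero] at hlim0
    refine squeeze_zero_norm' (a := fun n : ℕ => Real.exp ((‖G‖ + 1) * |t|) *
      ((n : ℝ) * ‖F (t / n) - NormedSpace.exp ((t / (n : ℝ)) • G)‖)) ?_ hlim0
    filter_upwards [bound hF hF0, bound hE (by simp), eventually_ge_atTop 1] with n h1 h2 hn
    have hn' : (0 : ℝ) < n := by exact_mod_cast hn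
    refine (norm_pow_sub_pow_le_mul (Real.one_le_exp (by positivity)) h1 h2 n).trans_eq ?_
    rw [← Real.exp_nat_mul, abs_div, Nat.abs_cast]
    have : (n : ℝ) * ((‖G‖ + 1) * (|t| / n)) = (‖G‖ + 1) * |t| := by field_simp
    rw [this]; ring
  have hpow : ∀ᶠ n : ℕ in atTop,
      NormedSpace.exp ((t / (n : ℝ)) • G) ^ n = NormedSpace.exp (t • G) := by
    filter_upwards [eventually_ge_atTop 1] with n hn
    have hn' : (n : ℝ) ≠ 0 := by positivity
    let _ : NormedAlgebra ℚ A := NormedAlgebra.restrictScalars ℚ ℝ A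
    rw [← NormedSpace.exp_nsmul, ← Nat.cast_smul_eq_nsmul ℝ, smul_smul, mul_div_cancel₀ _ hn']
  have := key.add (tendsto_const_nhds (x := NormedSpace.exp (t • G)))
  rw [zero_add] at this
  refine this.congr' ?_
  filter_upwards [hpow] with n hn
  rw [hn, sub_add_cancel]

section

attribute [local instance] Matrix.linftyOpNormedRing Matrix.linftyOpNormedAlgebra
  Matrix.linfty_opNormOneClass

/-- The operator norm is only a tool of the proof: hypotheses are entrywise and the limit is in the
product topology. -/
theorem Matrix.tendsto_pow_exp {Ω : Type*} [Fintype Ω] [DecidableEq Ω] {F : ℝ → Matrix Ω Ω ℝ}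
    {G : Matrix Ω Ω ℝ} (hF : ∀ x y, HasDerivAt (fun h => F h x y) (G x y) 0) (hF0 : F 0 = 1)
    (t : ℝ) :
    Tendsto (fun n : ℕ => F (t / n) ^ n) atTop (𝓝 (NormedSpace.exp (t • G))) := by
  cases isEmpty_or_nonempty Ω
  · simp [Subsingleton.elim _ (0 : Matrix Ω Ω ℝ)]
  refine HasDerivAt.tendsto_pow_exp (A := Matrix Ω Ω ℝ) ?_ hF0 t
  have h := HasDerivAt.fun_sum (u := Finset.univ) fun x _ =>
    HasDerivAt.fun_sum (u := Finset.univ) fun y _ =>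
      (hF x y).smul_const (Matrix.single x y (1 : ℝ))
  have e1 : (fun s => ∑ x, ∑ y, F s x y • Matrix.single x y (1 : ℝ)) = F := by
    funext s
    conv_rhs => rw [Matrix.matrix_eq_sum_single (F s)]
    simp
  have e2 : ∑ x, ∑ y, G x y • Matrix.single x y (1 : ℝ) = G := by
    conv_rhs => rw [Matrix.matrix_eq_sum_single G]
    simp
  rw [e1, e2] at h
  exact h

end

namespace NoisyVoter

/-! ### Finite Markov semigroups -/

section MarkovChains

open Matrix

variable {Ω : Type*} [Fintype Ω] [DecidableEq Ω]

theorem generator_mulVec (r : Ω → Ω → ℝ) (F : Ω → ℝ) (x : Ω) :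
    (generator r *ᵥ F) x = ∑ y, r x y * (F y - F x) := by
  have h1 : (generator r *ᵥ F) x = generator r x x * F x +
      ∑ y ∈ Finset.univ.erase x, generator r x y * F y :=
    (Finset.add_sum_erase _ _ (Finset.mem_univ x)).symm
  have h2 : ∀ y ∈ Finset.univ.erase x, generator r x y * F y = r x y * F y := by
    intro y hy
    simp [generator, (Finset.ne_of_mem_erase hy).symm]
  rw [h1, Finset.sum_congr rfl h2, ← Finset.add_sum_erase _ _ (Finset.mem_univ x)]
  simp [generator, mul_sub, ← Finset.sum_mul]
  ring

theorem one_add_smul_generator_mem {r : Ω → Ω → ℝ} (hr : ∀ x y, x ≠ y → 0 ≤ r x y) {h : ℝ}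
    (hh : 0 ≤ h) (hle : ∀ x, h * ∑ z ∈ Finset.univ.erase x, r x z ≤ 1) :
    1 + h • generator r ∈ rowStochastic ℝ Ω := by
  refine mem_rowStochastic.2 ⟨fun x y => ?_, ?_⟩
  · by_cases hxy : x = y
    · subst hxy
      have := hle x
      simp [generator] at this ⊢
      linarith
    · simpa [generator, hxy] using mul_nonneg hh (hr x y hxy)
  · ext x
    simp [add_mulVec, smul_mulVec, generator_mulVec]

theorem eventually_one_add_smul_generator_mem {r : Ω → Ω → ℝ} (hr : ∀ x y, x ≠ y → 0 ≤ r x y)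
    {t : ℝ} (ht : 0 ≤ t) :
    ∀ᶠ n : ℕ in atTop, 1 + (t / (n : ℝ)) • generator r ∈ rowStochastic ℝ Ω := by
  have hlim := tendsto_const_div_atTop_nhds_zero_nat t
  have h : ∀ᶠ n : ℕ in atTop, ∀ x, t / (n : ℝ) * ∑ z ∈ Finset.univ.erase x, r x z ≤ 1 := by
    refine eventually_all.2 fun x => ?_
    have := hlim.mul_const (∑ z ∈ Finset.univ.erase x, r x z)
    rw [zero_mul] at this
    exact this.eventually_le_const one_pos
  filter_upwards [h] with n hn
  exact one_add_smul_generator_mem hr (by positivity) hn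

theorem tendsto_one_add_smul_pow (G : Matrix Ω Ω ℝ) (t : ℝ) :
    Tendsto (fun n : ℕ => (1 + (t / (n : ℝ)) • G) ^ n) atTop (𝓝 (NormedSpace.exp (t • G))) := by
  refine Matrix.tendsto_pow_exp (F := fun h => 1 + h • G) (fun x y => ?_) (by simp) t
  simpa using ((hasDerivAt_id (0 : ℝ)).mul_const (G x y)).const_add ((1 : Matrix Ω Ω ℝ) x y)

theorem isClosed_rowStochastic : IsClosed (rowStochastic ℝ Ω : Set (Matrix Ω Ω ℝ)) := by
  have : (rowStochastic ℝ Ω : Set (Matrix Ω Ω ℝ)) =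
      (⋂ x, ⋂ y, {A | 0 ≤ A x y}) ∩ ⋂ x, {A | ∑ y, A x y = 1} := by
    ext A
    simp [mem_rowStochastic_iff_sum]
  rw [this]
  refine (isClosed_iInter fun x => isClosed_iInter fun y => ?_).inter (isClosed_iInter fun x => ?_)
  · exact isClosed_le continuous_const (by fun_prop)
  · exact isClosed_eq (by fun_prop) continuous_const

theorem exp_smul_generator_mem {r : Ω → Ω → ℝ} (hr : ∀ x y, x ≠ y → 0 ≤ r x y)
    {t : ℝ} (ht : 0 ≤ t) : NormedSpace.exp (t • generator r) ∈ rowStochastic ℝ Ω :=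
  isClosed_rowStochastic.mem_of_tendsto (tendsto_one_add_smul_pow _ t)
    ((eventually_one_add_smul_generator_mem hr ht).mono fun n hn => pow_mem hn n)

theorem mulVec_mono_of_mem_rowStochastic {A : Matrix Ω Ω ℝ} (hA : A ∈ rowStochastic ℝ Ω)
    {v w : Ω → ℝ} (h : v ≤ w) : A *ᵥ v ≤ A *ᵥ w := fun _ =>
  Finset.sum_le_sum fun y _ => mul_le_mul_of_nonneg_left (h y) (nonneg_of_mem_rowStochastic hA)

/-- A Grönwall inequality: the Euler step `1 + (t / n) • generator r` is eventually stochastic,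
hence monotone, so the one-step bound can be iterated before passing to the limit. -/
theorem exp_smul_generator_mulVec_le {r : Ω → Ω → ℝ} (hr : ∀ x y, x ≠ y → 0 ≤ r x y)
    {t : ℝ} (ht : 0 ≤ t) {c : ℝ} {w : Ω → ℝ}
    (hw : generator r *ᵥ w ≤ -c • w) :
    NormedSpace.exp (t • generator r) *ᵥ w ≤ Real.exp (-c * t) • w := by
  have h1 : Tendsto (fun n : ℕ => (1 + (t / (n : ℝ)) • generator r) ^ n *ᵥ w) atTop
      (𝓝 (NormedSpace.exp (t • generator r) *ᵥ w)) :=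
    ((continuous_id.matrix_mulVec continuous_const).tendsto _).comp
      (tendsto_one_add_smul_pow (generator r) t)
  have h2 : Tendsto (fun n : ℕ => (1 + (-c * t) / (n : ℝ)) ^ n • w) atTop
      (𝓝 (Real.exp (-c * t) • w)) :=
    (Real.tendsto_one_add_div_pow_exp (-c * t)).smul_const w
  have h3 : ∀ᶠ n : ℕ in atTop, 0 ≤ 1 + (-c * t) / (n : ℝ) := by
    have := (tendsto_const_div_atTop_nhds_zero_nat (-c * t)).const_add 1
    exact (this.eventually_const_lt (by norm_num : (0 : ℝ) < 1 + 0)).mono fun n hn => hn.le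
  refine le_of_tendsto_of_tendsto h1 h2 ?_
  filter_upwards [eventually_one_add_smul_generator_mem hr ht, h3] with n hn hc
  have step : (1 + (t / (n : ℝ)) • generator r) *ᵥ w ≤ (1 + (-c * t) / (n : ℝ)) • w := by
    intro x
    have := mul_le_mul_of_nonneg_left (hw x) (by positivity : 0 ≤ t / (n : ℝ))
    simp only [add_mulVec, one_mulVec, smul_mulVec, Pi.add_apply, Pi.smul_apply,
      smul_eq_mul] at this ⊢
    linarith [show (1 + -c * t / (n : ℝ)) * w x = w x + t / n * (-c * w x) by ring]
  have main : ∀ k : ℕ, (1 + (t / (n : ℝ)) • generator r) ^ k *ᵥ w ≤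
      (1 + (-c * t) / (n : ℝ)) ^ k • w := by
    intro k
    induction k with
    | zero => simp
    | succ k ih =>
      rw [pow_succ', ← mulVec_mulVec]
      refine (mulVec_mono_of_mem_rowStochastic hn ih).trans ?_
      rw [mulVec_smul, pow_succ, mul_smul]
      exact smul_le_smul_of_nonneg_left step (pow_nonneg hc k)
  exact main n

theorem exp_smul_generator_mulVec_eq {r : Ω → Ω → ℝ} (hr : ∀ x y, x ≠ y → 0 ≤ r x y)
    {t : ℝ} (ht : 0 ≤ t) {c : ℝ} {w : Ω → ℝ}
    (hw : generator r *ᵥ w = -c • w) :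
    NormedSpace.exp (t • generator r) *ᵥ w = Real.exp (-c * t) • w := by
  refine le_antisymm (exp_smul_generator_mulVec_le hr ht hw.le) ?_
  have := exp_smul_generator_mulVec_le hr ht (c := c) (w := -w) (by
    rw [mulVec_neg, hw, smul_neg])
  rw [mulVec_neg, smul_neg] at this
  exact neg_le_neg_iff.1 this

theorem IsStationaryDistribution.vecMul_exp {r : Ω → Ω → ℝ} {π : Ω → ℝ}
    (hπ : IsStationaryDistribution r π) (t : ℝ) :
    π ᵥ* NormedSpace.exp (t • generator r) = π := by
  have h1 : Tendsto (fun n : ℕ => π ᵥ* (1 + (t / (n : ℝ)) • generator r) ^ n) atTop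
      (𝓝 (π ᵥ* NormedSpace.exp (t • generator r))) :=
    ((continuous_const.matrix_vecMul continuous_id).tendsto _).comp
      (tendsto_one_add_smul_pow (generator r) t)
  refine tendsto_nhds_unique h1 ?_
  have : ∀ n k : ℕ, π ᵥ* (1 + (t / (n : ℝ)) • generator r) ^ k = π := by
    intro n k
    induction k with
    | zero => simp
    | succ k ih => rw [pow_succ, ← vecMul_vecMul, ih, vecMul_add, vecMul_smul, hπ.2.2]; simp
  simp [this]

theorem IsStationaryDistribution.sum_mul_generator_mulVec {r : Ω → Ω → ℝ} {π : Ω → ℝ}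
    (hπ : IsStationaryDistribution r π) (F : Ω → ℝ) :
    ∑ x, π x * (generator r *ᵥ F) x = 0 := by
  have : π ⬝ᵥ generator r *ᵥ F = 0 := by rw [dotProduct_mulVec, hπ.2.2, zero_dotProduct]
  exact this

/-- Constants lie in the right kernel, so the left kernel contains some `v ≠ 0`. For a stochastic
`P` fixing `v`, `|v| ≤ |v| P` pointwise with equal total mass, so `|v|` is invariant too; normalize
it. -/
theorem exists_isStationaryDistribution [Nonempty Ω] {r : Ω → Ω → ℝ}
    (hr : ∀ x y, x ≠ y → 0 ≤ r x y) : ∃ π, IsStationaryDistribution r π := by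
  have hdet : (generator r).det = 0 := by
    refine exists_mulVec_eq_zero_iff.1 ⟨1, one_ne_zero, ?_⟩
    ext x
    simp [generator_mulVec]
  obtain ⟨v, hv0, hv⟩ := exists_vecMul_eq_zero_iff.2 hdet
  obtain ⟨n, hn, hn1⟩ := ((eventually_one_add_smul_generator_mem hr zero_le_one).and
    (eventually_ge_atTop 1)).exists
  set P := 1 + (1 / (n : ℝ)) • generator r with hP
  have hvP : v ᵥ* P = v := by rw [hP, vecMul_add, vecMul_smul, hv]; simp
  have hle : ∀ y, |v y| ≤ ∑ x, |v x| * P x y := by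
    intro y
    calc |v y| = |∑ x, v x * P x y| := by
          conv_lhs => rw [← hvP]
          rfl
      _ ≤ ∑ x, |v x * P x y| := Finset.abs_sum_le_sum_abs _ _
      _ = ∑ x, |v x| * P x y := by
          simp [abs_mul, abs_of_nonneg (nonneg_of_mem_rowStochastic hn)]
  have hsum : ∑ y, ∑ x, |v x| * P x y = ∑ y, |v y| := by
    rw [Finset.sum_comm]
    simp [← Finset.mul_sum, sum_row_of_mem_rowStochastic hn]
  have heq : ∀ y, |v y| = ∑ x, |v x| * P x y := fun y =>
    (Finset.sum_eq_sum_iff_of_le fun y _ => hle y).1 hsum.symm y (Finset.mem_univ y)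
  have hpos : 0 < ∑ x, |v x| := by
    obtain ⟨x, hx⟩ := Function.ne_iff.1 hv0
    exact Finset.sum_pos' (fun _ _ => abs_nonneg _) ⟨x, Finset.mem_univ x, abs_pos.2 hx⟩
  have habs : (fun x => |v x|) ᵥ* generator r = 0 := by
    have h1 : (fun x => |v x|) ᵥ* P = fun x => |v x| := funext fun y => (heq y).symm
    rw [hP, vecMul_add, vecMul_one, vecMul_smul, add_eq_left] at h1
    refine (smul_eq_zero.1 h1).resolve_left ?_
    positivity
  refine ⟨(∑ x, |v x|)⁻¹ • fun x => |v x|, fun x => ?_, ?_, ?_⟩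
  · simp only [Pi.smul_apply, smul_eq_mul]; positivity
  · simp [← Finset.mul_sum, hpos.ne']
  · rw [smul_vecMul, habs, smul_zero]

end MarkovChains

/-! ### Noise, copying and the splitting of the voter generator -/

open Matrix Filter Topology

noncomputable section


variable {S : Type*} [Fintype S] [DecidableEq S]

theorem voterRate_nonneg {q : S → S → ℝ} (hq : ∀ x y, x ≠ y → 0 ≤ q x y) (η ζ : S → Bool) :
    0 ≤ voterRate q η ζ := by
  refine Finset.sum_nonneg fun x _ => ?_
  split_ifs
  · refine add_nonneg (by norm_num) (Finset.sum_nonneg fun y hy => ?_)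
    split_ifs
    exacts [le_rfl, hq x y (Finset.ne_of_mem_erase hy).symm]
  · exact le_rfl

theorem generator_voterRate_mulVec (q : S → S → ℝ) (F : (S → Bool) → ℝ) (η : S → Bool) :
    (generator (voterRate q) *ᵥ F) η = ∑ x, flipRate q η x * (F (flip η x) - F η) := by
  rw [generator_mulVec]
  simp only [voterRate, Finset.sum_mul]
  rw [Finset.sum_comm]
  simp

/-- A bit as a sign. -/
def spin (b : Bool) : ℝ := if b then 1 else -1

@[simp] theorem spin_true : spin true = 1 := rfl
@[simp] theorem spin_false : spin false = -1 := rfl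

/-- The probability that a bit `σ` becomes `a` in the symmetric channel of correlation `c`. -/
def bitNoise (c : ℝ) (σ a : Bool) : ℝ := (1 + c * (spin σ * spin a)) / 2

theorem bitNoise_nonneg {c : ℝ} (h0 : 0 ≤ c) (h1 : c ≤ 1) (σ a : Bool) : 0 ≤ bitNoise c σ a := by
  cases σ <;> cases a <;> simp [bitNoise] <;> linarith

theorem sum_bitNoise (c : ℝ) (σ : Bool) : ∑ a, bitNoise c σ a = 1 := by
  cases σ <;> simp [bitNoise] <;> ring

theorem sum_bitNoise_mul (c d : ℝ) (σ a : Bool) :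
    ∑ τ, bitNoise c σ τ * bitNoise d τ a = bitNoise (c * d) σ a := by
  cases σ <;> cases a <;> simp [bitNoise] <;> ring

theorem bitNoise_one (σ a : Bool) : bitNoise 1 σ a = if σ = a then 1 else 0 := by
  cases σ <;> cases a <;> simp [bitNoise]

/-- The product over all sites of symmetric channels of correlation `c`. -/
def noise (c : ℝ) : Matrix (S → Bool) (S → Bool) ℝ := of fun η a => ∏ x, bitNoise c (η x) (a x)

omit [DecidableEq S] in
theorem noise_apply (c : ℝ) (η a : S → Bool) : noise c η a = ∏ x, bitNoise c (η x) (a x) := rfl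

theorem noise_mul (c d : ℝ) :
    (noise c * noise d : Matrix (S → Bool) (S → Bool) ℝ) = noise (c * d) := by
  ext η a
  simp only [mul_apply, noise_apply, ← Finset.prod_mul_distrib]
  rw [← Fintype.prod_sum fun x b => bitNoise c (η x) b * bitNoise d b (a x)]
  exact Finset.prod_congr rfl fun x _ => sum_bitNoise_mul c d (η x) (a x)

omit [DecidableEq S] in
theorem noise_one : (noise 1 : Matrix (S → Bool) (S → Bool) ℝ) = 1 := by
  ext η a
  simp [noise_apply, bitNoise_one, one_apply, Finset.prod_ite_zero, funext_iff]

theorem noise_pow (c : ℝ) (n : ℕ) :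
    (noise c : Matrix (S → Bool) (S → Bool) ℝ) ^ n = noise (c ^ n) := by
  induction n with
  | zero => simp [noise_one]
  | succ n ih => rw [pow_succ, ih, noise_mul, pow_succ]

/-- The deterministic transition from `η` to `η ∘ f`. -/
def pull (f : S → S) : Matrix (S → Bool) (S → Bool) ℝ := of fun η a => if a = η ∘ f then 1 else 0

theorem pull_mul_apply (f : S → S) (A : Matrix (S → Bool) (S → Bool) ℝ) (η a : S → Bool) :
    (pull f * A) η a = A (η ∘ f) a := by
  simp [mul_apply, pull]

theorem pull_mulVec (f : S → S) (F : (S → Bool) → ℝ) (η : S → Bool) :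
    (pull f *ᵥ F) η = F (η ∘ f) := by
  simp [mulVec, dotProduct, pull]

theorem pull_mul_pull (f g : S → S) : pull f * pull g = pull (f ∘ g) := by
  ext η a
  rw [pull_mul_apply]
  rfl

omit [DecidableEq S] in
theorem pull_id : pull (id : S → S) = 1 := by
  ext η a
  simp [pull, one_apply, eq_comm]

/-- The generator of voting alone. -/
def votingGenerator (q : S → S → ℝ) : Matrix (S → Bool) (S → Bool) ℝ :=
  ∑ x, ∑ y ∈ Finset.univ.erase x, q x y • (pull (Function.update id x y) - 1)

theorem votingGenerator_mulVec (q : S → S → ℝ) (F : (S → Bool) → ℝ) (η : S → Bool) :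
    (votingGenerator q *ᵥ F) η = ∑ x, (flipRate q η x - 1 / 2) * (F (flip η x) - F η) := by
  simp only [votingGenerator, sum_mulVec, Finset.sum_apply, smul_mulVec, sub_mulVec, one_mulVec,
    Pi.smul_apply, Pi.sub_apply, pull_mulVec, flipRate, smul_eq_mul]
  refine Finset.sum_congr rfl fun x _ => ?_
  rw [add_sub_cancel_left, Finset.sum_mul]
  refine Finset.sum_congr rfl fun y _ => ?_
  have : η ∘ Function.update id x y = Function.update η x (η y) := by
    rw [Function.comp_update, Function.comp_id]
  rw [this]
  split_ifs with h
  · simp [h]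
  · have h' : η y = !η x := by
      cases hx : η x <;> cases hy : η y <;> simp_all
    rw [h', flip]

theorem hasDerivAt_bitNoise (σ a : Bool) :
    HasDerivAt (fun h : ℝ => bitNoise (Real.exp (-h)) σ a) (-(spin σ * spin a) / 2) 0 := by
  have h1 : HasDerivAt (fun h : ℝ => Real.exp (-h)) (-1) 0 := by
    simpa using (hasDerivAt_neg (0 : ℝ)).exp
  simpa [bitNoise] using ((h1.mul_const (spin σ * spin a)).const_add 1).div_const 2

theorem hasDerivAt_noise (η a : S → Bool) :
    HasDerivAt (fun h : ℝ => noise (Real.exp (-h)) η a)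
      (generator (voterRate fun _ _ => 0) η a) 0 := by
  have h := HasDerivAt.fun_finsetProd (u := Finset.univ)
    fun x _ => hasDerivAt_bitNoise (η x) (a x)
  have hgen : generator (voterRate fun _ _ => 0) η a =
      ∑ x, 1 / 2 * ((if flip η x = a then (1 : ℝ) else 0) - if η = a then 1 else 0) := by
    have h2 := generator_voterRate_mulVec (fun _ _ => 0) (Pi.single a 1) η
    rw [mulVec_single_one] at h2
    simpa [flipRate, Pi.single_apply] using h2
  rw [hgen]
  refine h.congr_deriv (Finset.sum_congr rfl fun x _ => ?_)
  simp only [neg_zero, Real.exp_zero, bitNoise_one, Finset.prod_ite_zero, Finset.prod_const_one,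
    smul_eq_mul]
  -- The product rule differentiates the factor at `x`; at time `0` the other factors force
  -- agreement off `x`.
  by_cases hx : ∀ y ∈ Finset.univ.erase x, η y = a y
  · rw [if_pos hx]
    have ha : a = Function.update η x (a x) := by
      funext y
      by_cases hy : y = x
      · subst hy; simp
      · simp [hy, hx y (Finset.mem_erase.2 ⟨hy, Finset.mem_univ y⟩)]
    have hne : η x ≠ a x → η ≠ a := fun h1 h2 => h1 (by rw [h2])
    by_cases hxa : η x = a x
    · have h2 : η = a := by rw [ha, ← hxa, Function.update_eq_self]
      have h3 : flip η x ≠ a := by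
        intro h4
        have := congrFun h4 x
        simp [flip, hxa] at this
      rw [if_neg h3, if_pos h2, hxa]
      cases a x <;> norm_num
    · have h3 : flip η x = a := by
        have h4 := (by decide : ∀ u v : Bool, u ≠ v → v = !u) _ _ hxa
        rw [ha, h4, flip]
      rw [if_pos h3, if_neg (hne hxa)]
      revert hxa
      cases η x <;> cases a x <;> simp
  · rw [if_neg hx]
    have h2 : η ≠ a := fun h2 => hx fun y _ => by rw [h2]
    have h3 : flip η x ≠ a := fun h2 => hx fun y hy => by
      rw [← h2, flip, Function.update_of_ne (Finset.ne_of_mem_erase hy)]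
    simp [h2, h3]

theorem generator_voterRate_eq (q : S → S → ℝ) :
    generator (voterRate q) = generator (voterRate fun _ _ => 0) + votingGenerator q := by
  refine Matrix.ext_of_mulVec_single fun a => funext fun η => ?_
  rw [add_mulVec, Pi.add_apply, votingGenerator_mulVec, generator_voterRate_mulVec,
    generator_voterRate_mulVec, ← Finset.sum_add_distrib]
  refine Finset.sum_congr rfl fun x _ => ?_
  simp [flipRate]
  ring

/-- Trotter splitting: the derivative of the product at `0` is the sum of the rerandomization and
voting generators. -/
theorem tendsto_noise_mul_pow (q : S → S → ℝ) (t : ℝ) :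
    Tendsto (fun n : ℕ =>
        (noise (Real.exp (-(t / n))) * (1 + (t / (n : ℝ)) • votingGenerator q)) ^ n) atTop (𝓝 (NormedSpace.exp (t • generator (voterRate q)))) := by
  refine Matrix.tendsto_pow_exp
    (F := fun h => noise (Real.exp (-h)) * (1 + h • votingGenerator q)) (fun η a => ?_)
    (by simp [noise_one]) t
  have hV : ∀ ζ, HasDerivAt (fun h : ℝ => (1 + h • votingGenerator q) ζ a)
      (votingGenerator q ζ a) 0 := fun ζ => by
    simpa using ((hasDerivAt_id (0 : ℝ)).mul_const (votingGenerator q ζ a)).const_add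
      ((1 : Matrix (S → Bool) (S → Bool) ℝ) ζ a)
  have h := HasDerivAt.fun_sum (u := Finset.univ)
    fun ζ _ => (hasDerivAt_noise η ζ).fun_mul (hV ζ)
  refine h.congr_deriv ?_
  rw [generator_voterRate_eq q]
  simp [noise_one, Finset.sum_add_distrib, one_apply]

theorem hypercubeLaw_eq (t : ℝ) (η : S → Bool) : hypercubeLaw t η = noise (Real.exp (-t)) η := by
  have h1 : Tendsto (fun n : ℕ => (noise (Real.exp (-(t / n))) :
      Matrix (S → Bool) (S → Bool) ℝ) ^ n) atTop
      (𝓝 (NormedSpace.exp (t • generator (voterRate fun _ _ => 0)))) :=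
    Matrix.tendsto_pow_exp hasDerivAt_noise (by simp [noise_one]) t
  have h2 : NormedSpace.exp (t • generator (voterRate fun _ _ => 0)) =
      (noise (Real.exp (-t)) : Matrix (S → Bool) (S → Bool) ℝ) := by
    refine tendsto_nhds_unique h1 (tendsto_const_nhds.congr' ?_)
    filter_upwards [eventually_ge_atTop 1] with n hn
    have : (n : ℝ) ≠ 0 := by positivity
    rw [noise_pow, ← Real.exp_nat_mul]
    congr 2
    field_simp
  exact congrFun h2 η

/-! ### Postponing noise past a merger of sites -/

/-- The law of a further bit `c` given the likelihoods `u`, `v` of a hidden bit can be produced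
from a more noisy observation which ignores the hidden bit. -/
theorem exists_bit_kernel {θ φ : ℝ} (hθ0 : 0 ≤ θ) (hθ1 : θ ≤ 1) (hφ0 : 0 ≤ φ) (u v : ℝ) :
    ∃ k : Bool → Bool → ℝ, (∀ b c, 0 ≤ k b c) ∧ (∀ b, ∑ c, k b c = 1) ∧
      (0 ≤ u → 0 ≤ v → (u = v ∨ φ * (u + v) ≤ |u - v|) → ∀ σ c,
        (∑ τ, bitNoise θ σ τ * cond τ u v) * ∑ b, bitNoise (θ * φ) σ b * k b c =
          ∑ τ, bitNoise θ σ τ * cond τ u v * bitNoise φ τ c) := by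
  -- Outside the useful range the identity kernel serves as a default, so that `k` can be chosen for
  -- all `u`, `v`.
  by_cases hu : 0 ≤ u ∧ 0 ≤ v ∧ (u = v ∨ φ * (u + v) ≤ |u - v|)
  swap
  · exact ⟨fun b c => if b = c then 1 else 0, fun b c => by positivity, fun b => by simp,
      fun h1 h2 h3 => absurd ⟨h1, h2, h3⟩ hu⟩
  obtain ⟨hu, hv, huv⟩ := hu
  have hDP : |u - v| ≤ u + v := abs_le.2 ⟨by linarith, by linarith⟩
  have hDP2 : (u - v) ^ 2 ≤ (u + v) ^ 2 := by nlinarith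
  have hθD : θ ^ 2 * (u - v) ^ 2 ≤ (u - v) ^ 2 :=
    mul_le_of_le_one_left (sq_nonneg _) (by nlinarith)
  rcases eq_or_lt_of_le (hθD.trans hDP2) with h0 | h0
  · refine ⟨fun b c => if b = c then 1 else 0, fun b c => by positivity, fun b => by simp, ?_⟩
    intro _ _ _ σ c
    have h1 : u * v = 0 := by nlinarith
    have h2 : (1 - θ ^ 2) * (u - v) ^ 2 = 0 := by nlinarith
    have h3 : θ = 1 ∨ u - v = 0 := by
      rcases mul_eq_zero.1 h2 with h | h
      · left; nlinarith
      · right; exact pow_eq_zero_iff two_ne_zero |>.1 h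
    rcases h3 with h3 | h3
    · subst h3
      rcases mul_eq_zero.1 h1 with h | h <;> subst h <;> cases σ <;> cases c <;>
        simp [bitNoise]
    · have : u = v := by linarith
      subst this
      have : u = 0 := by simpa using h1
      subst this
      simp
  -- The output spin is to have mean `m + l * spin b`. For `σ` of sign `s` this requires `m + l * (θ
  -- * φ * s)` to equal `φ * ((u - v) + θ * s * (u + v)) / ((u + v) + θ * s * (u - v))`. Multiplying
  -- numerator and denominator by the conjugate gives denominator `E`; the parts even and odd in `s`
  -- give `m` and `l`. Positivity of the kernel is `|m| + l ≤ 1`, which is where the alternative on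
  -- `u`, `v` enters.
  · set E := (u + v) ^ 2 - θ ^ 2 * (u - v) ^ 2 with hE
    have hE0 : 0 < E := by linarith
    set l := ((u + v) ^ 2 - (u - v) ^ 2) / E with hl
    set m := φ * (1 - θ ^ 2) * ((u - v) * (u + v)) / E with hm
    have hlE : l * E = (u + v) ^ 2 - (u - v) ^ 2 := by rw [hl]; field_simp
    have hmE : m * E = φ * (1 - θ ^ 2) * ((u - v) * (u + v)) := by rw [hm]; field_simp
    have hl0 : 0 ≤ l := div_nonneg (by linarith) hE0.le
    have hml : |m| + l ≤ 1 := by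
      have h1 : |m| * E ≤ (1 - θ ^ 2) * (u - v) ^ 2 := by
        have h0 : |m| * E = |m * E| := by rw [abs_mul, abs_of_pos hE0]
        rw [h0, hmE, abs_mul, abs_mul, abs_mul,
          abs_of_nonneg hφ0, abs_of_nonneg (by nlinarith : 0 ≤ 1 - θ ^ 2),
          abs_of_nonneg (by linarith : 0 ≤ u + v), ← sq_abs (u - v)]
        have h2 : φ * (u + v) * |u - v| ≤ |u - v| * |u - v| := by
          rcases huv with h | h
          · simp [h]
          · exact mul_le_mul_of_nonneg_right h (abs_nonneg _)
        have := mul_le_mul_of_nonneg_left h2 (by nlinarith : 0 ≤ 1 - θ ^ 2)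
        linarith
      have h3 : (|m| + l) * E ≤ 1 * E := by rw [add_mul, hlE]; linarith
      exact le_of_mul_le_mul_right h3 hE0
    have hm1 := neg_abs_le m
    have hm2 := le_abs_self m
    refine ⟨fun b c => (1 + spin c * (m + l * spin b)) / 2, ?_, ?_, ?_⟩
    · intro b c
      cases b <;> cases c <;> simp <;> linarith
    · intro b
      cases b <;> simp <;> ring
    · intro _ _ _ σ c
      have gen : ∀ s : ℝ, s * s = 1 → ((u + v) + θ * s * (u - v)) * (m + l * (θ * φ * s)) =
          φ * ((u - v) + θ * s * (u + v)) := by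
        intro s hs
        apply mul_right_cancel₀ hE0.ne'
        have h1 : ((u + v) + θ * s * (u - v)) * (m + l * (θ * φ * s)) * E =
            ((u + v) + θ * s * (u - v)) * (m * E + l * E * (θ * φ * s)) := by ring
        rw [h1, hmE, hlE, hE]
        linear_combination (4 * θ ^ 2 * φ * (u - v) * u * v) * hs
      have gen1 := gen 1 (by norm_num)
      have gen2 := gen (-1) (by norm_num)
      cases σ <;> cases c <;> simp [bitNoise]
      · linear_combination (-1 / 4) * gen2
      · linear_combination (1 / 4) * gen2
      · linear_combination (-1 / 4) * gen1
      · linear_combination (1 / 4) * gen1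

omit [Fintype S] [DecidableEq S] in
-- Only the difference between the numbers of ones and zeros matters. If they are equal the
-- observations are uninformative; otherwise they are at least as informative as a single one, whose
-- contrast is `φ`.
theorem prod_bitNoise_alternative {φ : ℝ} (hφ0 : 0 ≤ φ) (hφ1 : φ ≤ 1) (B : Finset S)
    (a : S → Bool) :
    (∏ x ∈ B, bitNoise φ true (a x) = ∏ x ∈ B, bitNoise φ false (a x)) ∨
      φ * (∏ x ∈ B, bitNoise φ true (a x) + ∏ x ∈ B, bitNoise φ false (a x)) ≤
        |∏ x ∈ B, bitNoise φ true (a x) - ∏ x ∈ B, bitNoise φ false (a x)| := by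
  set p := (1 + φ) / 2 with hp
  set r := (1 - φ) / 2 with hr
  have hp0 : 0 ≤ p := by linarith
  have hr0 : 0 ≤ r := by linarith
  have hrp : r ≤ p := by linarith
  have hφ : φ = p - r := by linarith
  have h1 : p + r = 1 := by linarith
  obtain ⟨i, j, hi, hj⟩ : ∃ i j : ℕ, ∏ x ∈ B, bitNoise φ true (a x) = p ^ i * r ^ j ∧
      ∏ x ∈ B, bitNoise φ false (a x) = r ^ i * p ^ j := by
    refine ⟨(B.filter fun x => a x = true).card, (B.filter fun x => ¬ a x = true).card, ?_, ?_⟩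
    all_goals
      rw [← Finset.prod_filter_mul_prod_filter_not B (fun x => a x = true),
        ← Finset.prod_const, ← Finset.prod_const]
      congr 1 <;> refine Finset.prod_congr rfl fun x hx => ?_
    · rw [(Finset.mem_filter.1 hx).2]; simp [bitNoise, hp]
    · rw [eq_false_of_ne_true (Finset.mem_filter.1 hx).2]; simp [bitNoise, hr]; ring
    · rw [(Finset.mem_filter.1 hx).2]; simp [bitNoise, hr]; ring
    · rw [eq_false_of_ne_true (Finset.mem_filter.1 hx).2]; simp [bitNoise, hp]
  have key : ∀ m : ℕ, φ * (p ^ (m + 1) + r ^ (m + 1)) ≤ p ^ (m + 1) - r ^ (m + 1) := by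
    intro m
    have h2 : r ^ m ≤ p ^ m := pow_le_pow_left₀ hr0 hrp m
    have h3 := mul_le_mul_of_nonneg_left h2 (mul_nonneg hp0 hr0)
    have h4 : p ^ (m + 1) - r ^ (m + 1) = (p + r) * (p ^ (m + 1) - r ^ (m + 1)) := by
      rw [h1, one_mul]
    rw [h4, hφ, pow_succ, pow_succ]
    nlinarith
  rw [hi, hj]
  rcases lt_trichotomy i j with h | h | h
  · right
    obtain ⟨m, rfl⟩ := Nat.exists_eq_add_of_lt h
    have h2 := mul_le_mul_of_nonneg_left (key m) (by positivity : 0 ≤ p ^ i * r ^ i)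
    refine le_trans ?_ (neg_le_abs _)
    convert h2 using 1 <;> ring
  · left; rw [h, mul_comm]
  · right
    obtain ⟨m, rfl⟩ := Nat.exists_eq_add_of_lt h
    have h2 := mul_le_mul_of_nonneg_left (key m) (by positivity : 0 ≤ p ^ j * r ^ j)
    refine le_trans ?_ (le_abs_self _)
    convert h2 using 1 <;> ring

/-- Each site `y` receives a bit `τ y` through a channel of correlation `θ`. The sites `x ∈ A`
observe `τ (f x)` through channels of correlation `φ`, the others observe `η (f x)` through
independent channels of correlation `θ * φ`. -/
def partialNoise (θ φ : ℝ) (f : S → S) (A : Finset S) : Matrix (S → Bool) (S → Bool) ℝ :=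
  of fun η a => (∏ y, ∑ τ, bitNoise θ (η y) τ * ∏ x ∈ A with f x = y, bitNoise φ τ (a x)) *
    ∏ x ∈ Aᶜ, bitNoise (θ * φ) (η (f x)) (a x)

theorem partialNoise_empty (θ φ : ℝ) (f : S → S) :
    partialNoise θ φ f ∅ = pull f * noise (θ * φ) := by
  ext η a
  rw [pull_mul_apply]
  simp only [partialNoise, of_apply, Finset.filter_empty, Finset.prod_empty, mul_one, sum_bitNoise,
    Finset.prod_const_one, one_mul, Finset.compl_empty, noise_apply, Function.comp_apply]

theorem partialNoise_univ (θ φ : ℝ) (f : S → S) :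
    partialNoise θ φ f Finset.univ = noise θ * (pull f * noise φ) := by
  ext η a
  simp only [partialNoise, of_apply, Finset.compl_univ, Finset.prod_empty, mul_one,
    mul_apply (M := noise θ), pull_mul_apply, noise_apply, Function.comp_apply]
  rw [Fintype.prod_sum]
  refine Finset.sum_congr rfl fun ζ _ => ?_
  rw [Finset.prod_mul_distrib]
  congr 1
  rw [← Finset.prod_fiberwise (s := Finset.univ) (g := f)
    (f := fun x => bitNoise φ (ζ (f x)) (a x))]
  refine Finset.prod_congr rfl fun y _ => Finset.prod_congr rfl fun x hx => ?_
  rw [(Finset.mem_filter.1 hx).2]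

/-- `K` resamples only the state of `x`, by the one-bit kernel whose `u`, `v` are the likelihoods of
the states already seen at the sites of `A` with the same image under `f`. This correlates `x` with
them as the shared bit would. -/
theorem exists_partialNoise_insert {θ φ : ℝ} (hθ0 : 0 ≤ θ) (hθ1 : θ ≤ 1) (hφ0 : 0 ≤ φ)
    (hφ1 : φ ≤ 1) (f : S → S) {A : Finset S} {x : S} (hx : x ∉ A) :
    ∃ K ∈ rowStochastic ℝ (S → Bool),
      partialNoise θ φ f (insert x A) = partialNoise θ φ f A * K := by
  choose k hk0 hk1 hk using fun u v => exists_bit_kernel hθ0 hθ1 hφ0 u v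
  let g : Bool → (S → Bool) → ℝ := fun τ a => ∏ z ∈ A with f z = f x, bitNoise φ τ (a z)
  have hg0 : ∀ τ a, 0 ≤ g τ a := fun τ a =>
    Finset.prod_nonneg fun z _ => bitNoise_nonneg hφ0 hφ1 _ _
  have hupd : ∀ (a : S → Bool) (b : Bool), ∀ z ∈ A, Function.update a x b z = a z :=
    fun a b z hz => Function.update_of_ne (fun h => hx (by rwa [← h])) _ _
  -- As `x ∉ A`, the parameters of the kernel agree before and after resampling `x`.
  have hg : ∀ τ a b, g τ (Function.update a x b) = g τ a := fun τ a b =>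
    Finset.prod_congr rfl fun z hz => by rw [hupd a b z (Finset.mem_filter.1 hz).1]
  have hcond : ∀ τ a, cond τ (g true a) (g false a) = g τ a := fun τ a => by cases τ <;> rfl
  have hkey : ∀ a σ c, (∑ τ, bitNoise θ σ τ * g τ a) *
      ∑ b, bitNoise (θ * φ) σ b * k (g true a) (g false a) b c =
        ∑ τ, bitNoise θ σ τ * g τ a * bitNoise φ τ c := by
    intro a σ c
    have := hk (g true a) (g false a) (hg0 _ _) (hg0 _ _)
      (prod_bitNoise_alternative hφ0 hφ1 _ a) σ c
    simpa only [hcond] using this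
  let K : Matrix (S → Bool) (S → Bool) ℝ := of fun a a' =>
    ∑ c, k (g true a) (g false a) (a x) c * if a' = Function.update a x c then 1 else 0
  refine ⟨K, mem_rowStochastic_iff_sum.2 ⟨fun a a' => ?_, fun a => ?_⟩, ?_⟩
  · simp only [K, of_apply]
    exact Finset.sum_nonneg fun c _ => mul_nonneg (hk0 _ _ _ _) (by positivity)
  · simp only [K, of_apply]
    rw [Finset.sum_comm]
    simp only [← Finset.mul_sum]
    simpa using hk1 (g true a) (g false a) (a x)
  · ext η a'
    -- the rest of the law does not involve the state of `x`
    let R := ∏ y ∈ Finset.univ.erase (f x),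
      ∑ τ, bitNoise θ (η y) τ * ∏ z ∈ A with f z = y, bitNoise φ τ (a' z)
    let T := ∏ z ∈ (insert x A)ᶜ, bitNoise (θ * φ) (η (f z)) (a' z)
    have hL : partialNoise θ φ f (insert x A) η a' =
        (∑ τ, bitNoise θ (η (f x)) τ * g τ a' * bitNoise φ τ (a' x)) * R * T := by
      simp only [partialNoise, of_apply]
      rw [← Finset.mul_prod_erase _ _ (Finset.mem_univ (f x))]
      congr 2
      · refine Finset.sum_congr rfl fun τ _ => ?_
        rw [Finset.filter_insert, if_pos rfl, Finset.prod_insert (by simp [hx])]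
        ring
      · refine Finset.prod_congr rfl fun y hy => Finset.sum_congr rfl fun τ _ => ?_
        rw [Finset.filter_insert, if_neg (Finset.ne_of_mem_erase hy).symm]
    have hM : ∀ b, partialNoise θ φ f A η (Function.update a' x b) =
        (∑ τ, bitNoise θ (η (f x)) τ * g τ a') * R * (bitNoise (θ * φ) (η (f x)) b * T) := by
      intro b
      simp only [partialNoise, of_apply]
      rw [← Finset.mul_prod_erase _ _ (Finset.mem_univ (f x))]
      congr 1
      · congr 1
        · refine Finset.sum_congr rfl fun τ _ => ?_
          rw [← hg τ a' b]
        · refine Finset.prod_congr rfl fun y hy => Finset.sum_congr rfl fun τ _ => ?_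
          congr 1
          exact Finset.prod_congr rfl fun z hz => by rw [hupd a' b z (Finset.mem_filter.1 hz).1]
      · rw [← Finset.mul_prod_erase Aᶜ _ (Finset.mem_compl.2 hx), ← Finset.compl_insert]
        congr 1
        · simp
        · refine Finset.prod_congr rfl fun z hz => ?_
          rw [Function.update_of_ne (by rintro rfl; simp at hz)]
    -- Inverts the update: the predecessors of `a'` under resampling are its two modifications at
    -- `x`.
    have hind : ∀ (a : S → Bool) (c : Bool), (if a' = Function.update a x c then (1 : ℝ) else 0) =
        if c = a' x then ∑ b, if a = Function.update a' x b then 1 else 0 else 0 := by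
      intro a c
      by_cases hc : c = a' x
      · subst hc
        rw [if_pos rfl]
        by_cases h : a' = Function.update a x (a' x)
        · rw [if_pos h]
          have h2 : ∀ b, a = Function.update a' x b ↔ b = a x := by
            intro b
            refine ⟨fun h3 => by rw [h3]; simp, fun h3 => ?_⟩
            rw [h, h3]; simp
          simp only [h2]
          rw [Finset.sum_ite_eq' Finset.univ (a x)]; simp
        · rw [if_neg h]
          refine (Finset.sum_eq_zero fun b _ => if_neg fun h2 => h ?_).symm
          rw [h2]; simp
      · rw [if_neg hc, if_neg]
        intro h
        apply hc
        rw [h]; simp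
    rw [hL, ← hkey a', mul_apply]
    have hK : ∀ a, K a a' = ∑ b, if a = Function.update a' x b then
        k (g true a') (g false a') b (a' x) else 0 := by
      intro a
      have h1 : K a a' = ∑ c, k (g true a) (g false a) (a x) c *
          if c = a' x then ∑ b, if a = Function.update a' x b then 1 else 0 else 0 := by
        simp only [K, of_apply]
        exact Finset.sum_congr rfl fun c _ => congrArg _ (hind a c)
      rw [h1, Finset.sum_eq_single (a' x) (fun c _ hc => by rw [if_neg hc, mul_zero]) (by simp),
        if_pos rfl, Finset.mul_sum]
      refine Finset.sum_congr rfl fun b _ => ?_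
      split_ifs with h
      · rw [h, hg, hg]; simp
      · simp
    simp only [hK, Finset.mul_sum]
    rw [Finset.sum_comm]
    simp only [mul_ite, mul_zero, Finset.sum_ite_eq', Finset.mem_univ, if_true, hM]
    generalize (∑ τ, bitNoise θ (η (f x)) τ * g τ a') = s
    simp only [Finset.sum_mul]
    refine Finset.sum_congr rfl fun b _ => ?_
    ring

/-- Noise before a merger of sites can be postponed: independent noise after the merger is more
informative. -/
theorem exists_noise_mul_pull_mul_noise {θ φ : ℝ} (hθ0 : 0 ≤ θ) (hθ1 : θ ≤ 1) (hφ0 : 0 ≤ φ)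
    (hφ1 : φ ≤ 1) (f : S → S) :
    ∃ K ∈ rowStochastic ℝ (S → Bool),
      noise θ * (pull f * noise φ) = pull f * noise (θ * φ) * K := by
  have h : ∀ A : Finset S, ∃ K ∈ rowStochastic ℝ (S → Bool),
      partialNoise θ φ f A = pull f * noise (θ * φ) * K := by
    intro A
    induction A using Finset.induction_on with
    | empty => exact ⟨1, one_mem _, by rw [partialNoise_empty, mul_one]⟩
    | insert x A hx ih =>
      obtain ⟨K, hK, hA⟩ := ih
      obtain ⟨K', hK', hA'⟩ := exists_partialNoise_insert hθ0 hθ1 hφ0 hφ1 f hx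
      exact ⟨K * K', mul_mem hK hK', by rw [hA', hA, mul_assoc]⟩
  simpa only [partialNoise_univ] using h Finset.univ

/-! ### Total variation under mixing and processing -/

section TotalVariation

variable {Ω : Type*} [Fintype Ω]

theorem tvDist_nonneg (p p' : Ω → ℝ) : 0 ≤ tvDist p p' :=
  mul_nonneg (by norm_num) (Finset.sum_nonneg fun _ _ => abs_nonneg _)

theorem tvDist_add_smul_le (p p' r r' : Ω → ℝ) {a b : ℝ} (ha : 0 ≤ a) (hb : 0 ≤ b) :
    tvDist (a • p + b • r) (a • p' + b • r') ≤ a * tvDist p p' + b * tvDist r r' := by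
  have : ∑ s, |(a • p + b • r) s - (a • p' + b • r') s| ≤
      ∑ s, (a * |p s - p' s| + b * |r s - r' s|) := by
    refine Finset.sum_le_sum fun s _ => ?_
    have h : (a • p + b • r) s - (a • p' + b • r') s = a * (p s - p' s) + b * (r s - r' s) := by
      simp only [Pi.add_apply, Pi.smul_apply, smul_eq_mul]; ring
    rw [h]
    refine (abs_add_le _ _).trans_eq ?_
    rw [abs_mul, abs_mul, abs_of_nonneg ha, abs_of_nonneg hb]
  rw [Finset.sum_add_distrib, ← Finset.mul_sum, ← Finset.mul_sum] at this
  simp only [tvDist]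
  linarith

theorem tvDist_vecMul_le [DecidableEq Ω] {K : Matrix Ω Ω ℝ} (hK : K ∈ rowStochastic ℝ Ω)
    (p p' : Ω → ℝ) : tvDist (p ᵥ* K) (p' ᵥ* K) ≤ tvDist p p' := by
  refine mul_le_mul_of_nonneg_left ?_ (by norm_num)
  calc ∑ s, |(p ᵥ* K) s - (p' ᵥ* K) s| = ∑ s, |∑ x, (p x - p' x) * K x s| := by
        simp [vecMul, dotProduct, sub_mul]
    _ ≤ ∑ s, ∑ x, |p x - p' x| * K x s := by
        refine Finset.sum_le_sum fun s _ => (Finset.abs_sum_le_sum_abs _ _).trans_eq ?_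
        simp [abs_mul, abs_of_nonneg (nonneg_of_mem_rowStochastic hK)]
    _ = ∑ x, |p x - p' x| := by
        rw [Finset.sum_comm]
        simp [← Finset.mul_sum, sum_row_of_mem_rowStochastic hK]

theorem continuous_tvDist : Continuous fun p : (Ω → ℝ) × (Ω → ℝ) => tvDist p.1 p.2 := by
  unfold tvDist
  fun_prop

/-- Mixing the rows of a matrix does not increase their distance. -/
theorem tvDist_vecMul_le_of_forall {A : Matrix Ω Ω ℝ} {d : ℝ}
    (hA : ∀ x y, tvDist (A x) (A y) ≤ d) {μ ν : Ω → ℝ} (hμ0 : ∀ x, 0 ≤ μ x) (hμ1 : ∑ x, μ x = 1)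
    (hν0 : ∀ x, 0 ≤ ν x) (hν1 : ∑ x, ν x = 1) : tvDist (μ ᵥ* A) (ν ᵥ* A) ≤ d := by
  have h1 : ∀ s, (μ ᵥ* A) s - (ν ᵥ* A) s = ∑ x, ∑ y, μ x * ν y * (A x s - A y s) := by
    intro s
    have e1 : ∑ x, ∑ y, μ x * ν y * A x s = (μ ᵥ* A) s := by
      simp [← Finset.mul_sum, ← Finset.sum_mul, hν1, vecMul, dotProduct]
    have e2 : ∑ x, ∑ y, μ x * ν y * A y s = (ν ᵥ* A) s := by
      rw [Finset.sum_comm]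
      simp [← Finset.sum_mul, hμ1, vecMul, dotProduct]
    simp only [mul_sub, Finset.sum_sub_distrib, e1, e2]
  have h2 : ∑ s, |(μ ᵥ* A) s - (ν ᵥ* A) s| ≤ ∑ s, ∑ x, ∑ y, μ x * ν y * |A x s - A y s| := by
    refine Finset.sum_le_sum fun s _ => ?_
    rw [h1]
    refine (Finset.abs_sum_le_sum_abs _ _).trans (Finset.sum_le_sum fun x _ =>
      (Finset.abs_sum_le_sum_abs _ _).trans_eq (Finset.sum_congr rfl fun y _ => ?_))
    rw [abs_mul, abs_of_nonneg (mul_nonneg (hμ0 x) (hν0 y))]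
  have h3 : ∑ s, ∑ x, ∑ y, μ x * ν y * |A x s - A y s| =
      ∑ x, ∑ y, μ x * ν y * ∑ s, |A x s - A y s| := by
    rw [Finset.sum_comm]
    refine Finset.sum_congr rfl fun x _ => ?_
    rw [Finset.sum_comm]
    simp [Finset.mul_sum]
  have h4 : ∑ x, ∑ y, μ x * ν y * ∑ s, |A x s - A y s| ≤ ∑ x, ∑ y, μ x * ν y * (2 * d) := by
    refine Finset.sum_le_sum fun x _ => Finset.sum_le_sum fun y _ =>
      mul_le_mul_of_nonneg_left ?_ (mul_nonneg (hμ0 x) (hν0 y))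
    have := hA x y
    simp only [tvDist] at this
    linarith
  have h5 : ∑ x, ∑ y, μ x * ν y * (2 * d) = 2 * d := by
    simp [← Finset.sum_mul, ← Finset.mul_sum, hμ1, hν1]
  simp only [tvDist]
  linarith

theorem eq_of_tvDist_le_zero {μ ν : Ω → ℝ} (h : tvDist μ ν ≤ 0) : μ = ν := by
  have h1 : ∑ s, |μ s - ν s| ≤ 0 := by simp only [tvDist] at h; linarith
  funext s
  have h2 := (Finset.sum_eq_zero_iff_of_nonneg fun s _ => abs_nonneg (μ s - ν s)).1
    (le_antisymm h1 (Finset.sum_nonneg fun _ _ => abs_nonneg _)) s (Finset.mem_univ s)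
  exact sub_eq_zero.1 (abs_eq_zero.1 h2)

theorem tvDist_le_sum (A : Ω → Ω → ℝ) (x y : Ω) :
    tvDist (A x) (A y) ≤ ∑ p : Ω × Ω, tvDist (A p.1) (A p.2) :=
  Finset.single_le_sum (f := fun p : Ω × Ω => tvDist (A p.1) (A p.2))
    (fun _ _ => tvDist_nonneg _ _) (Finset.mem_univ (x, y))

end TotalVariation

/-! ### Comparison with the hypercube, and uniqueness of the stationary law -/

/-- The mixtures of transitions which move the states of `η` around, then add noise of correlation
`c`, then process the result further. -/
def degradedNoise (S : Type*) [Fintype S] [DecidableEq S] (c : ℝ) :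
    Set (Matrix (S → Bool) (S → Bool) ℝ) :=
  convexHull ℝ {A | ∃ f : S → S, ∃ K ∈ rowStochastic ℝ (S → Bool), A = pull f * noise c * K}

theorem one_mem_degradedNoise : 1 ∈ degradedNoise S 1 :=
  subset_convexHull ℝ _ ⟨id, 1, one_mem _, by rw [pull_id, noise_one, one_mul, one_mul]⟩

/-- The product is linear in `A` and in `B`, so both may be taken among the generators of their
hulls; the new noise then passes the composite map `g ∘ f` and merges with the old. -/
theorem noise_mul_mem_degradedNoise {θ φ : ℝ} (hθ0 : 0 ≤ θ) (hθ1 : θ ≤ 1) (hφ0 : 0 ≤ φ)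
    (hφ1 : φ ≤ 1) {B A : Matrix (S → Bool) (S → Bool) ℝ}
    (hB : B ∈ convexHull ℝ (Set.range (pull : (S → S) → _))) (hA : A ∈ degradedNoise S φ) :
    noise θ * B * A ∈ degradedNoise S (θ * φ) := by
  have hconv : Convex ℝ (degradedNoise S (θ * φ)) := convex_convexHull ℝ _
  have h1 : ∀ g : S → S, noise θ * pull g * A ∈ degradedNoise S (θ * φ) := by
    intro g
    refine convexHull_min (t := (LinearMap.mulLeft ℝ (noise θ * pull g)) ⁻¹'
      degradedNoise S (θ * φ)) ?_ (hconv.linear_preimage _) hA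
    rintro _ ⟨f, K, hK, rfl⟩
    obtain ⟨K', hK', h⟩ := exists_noise_mul_pull_mul_noise hθ0 hθ1 hφ0 hφ1 (g ∘ f)
    refine subset_convexHull ℝ _ ⟨g ∘ f, K' * K, mul_mem hK' hK, ?_⟩
    rw [LinearMap.mulLeft_apply, ← mul_assoc _ K' K, ← h, ← pull_mul_pull]
    simp only [mul_assoc]
  refine convexHull_min (t := (LinearMap.mulRight ℝ A ∘ₗ LinearMap.mulLeft ℝ (noise θ)) ⁻¹'
    degradedNoise S (θ * φ)) ?_ (hconv.linear_preimage _) hB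
  rintro _ ⟨g, rfl⟩
  exact h1 g

theorem one_add_smul_votingGenerator_mem {q : S → S → ℝ} (hq : ∀ x y, x ≠ y → 0 ≤ q x y) {h : ℝ}
    (hh : 0 ≤ h) (hle : h * ∑ x, ∑ y ∈ Finset.univ.erase x, q x y ≤ 1) :
    1 + h • votingGenerator q ∈ convexHull ℝ (Set.range (pull : (S → S) → _)) := by
  -- `none` stands for no copying, `some ⟨x, y⟩` for `x` adopting the state of `y`.
  let w : Option (Σ _ : S, S) → ℝ := fun o => o.elim
    (1 - h * ∑ x, ∑ y ∈ Finset.univ.erase x, q x y) fun p => h * q p.1 p.2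
  let z : Option (Σ _ : S, S) → Matrix (S → Bool) (S → Bool) ℝ := fun o => o.elim 1
    fun p => pull (Function.update id p.1 p.2)
  let I : Finset (Σ _ : S, S) := Finset.univ.sigma fun x => Finset.univ.erase x
  have hw : ∑ i ∈ Finset.insertNone I, w i = 1 := by
    rw [Finset.sum_insertNone, Finset.sum_sigma]
    simp only [w, Option.elim, ← Finset.mul_sum]
    ring
  have hz : ∑ i ∈ Finset.insertNone I, w i • z i = 1 + h • votingGenerator q := by
    rw [Finset.sum_insertNone, Finset.sum_sigma]
    simp only [w, z, Option.elim, votingGenerator, Finset.smul_sum, smul_sub, mul_smul,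
      Finset.sum_sub_distrib, sub_smul, one_smul, Finset.mul_sum, Finset.sum_smul]
    abel
  rw [← hz]
  refine (convex_convexHull ℝ _).sum_mem (fun i hi => ?_) hw fun i _ => subset_convexHull ℝ _ ?_
  · cases i with
    | none => simpa [w] using hle
    | some p =>
      have hp : p ∈ I := Finset.some_mem_insertNone.1 hi
      exact mul_nonneg hh (hq _ _ (Finset.ne_of_mem_erase (Finset.mem_sigma.1 hp).2).symm)
  · cases i with
    | none => exact ⟨id, pull_id⟩
    | some p => exact ⟨_, rfl⟩

/-- The bound must be uniform over pairs because `f` replaces `η`, `ζ` by `η ∘ f`, `ζ ∘ f`. -/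
theorem tvDist_le_of_mem_degradedNoise {c d : ℝ}
    (hd : ∀ η ζ : S → Bool, tvDist (noise c η) (noise c ζ) ≤ d)
    {A : Matrix (S → Bool) (S → Bool) ℝ} (hA : A ∈ degradedNoise S c) (η ζ : S → Bool) :
    tvDist (A η) (A ζ) ≤ d := by
  refine convexHull_min (t := {A | tvDist (A η) (A ζ) ≤ d}) ?_ ?_ hA
  · rintro _ ⟨f, K, hK, rfl⟩
    have h : ∀ η : S → Bool, (pull f * noise c * K : Matrix (S → Bool) (S → Bool) ℝ) η =
        noise c (η ∘ f) ᵥ* K := by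
      intro η
      rw [mul_apply_eq_vecMul]
      congr 1
      exact funext fun a => pull_mul_apply f _ η a
    change tvDist ((pull f * noise c * K : Matrix (S → Bool) (S → Bool) ℝ) η)
      ((pull f * noise c * K : Matrix (S → Bool) (S → Bool) ℝ) ζ) ≤ d
    rw [h, h]
    exact (tvDist_vecMul_le hK _ _).trans (hd _ _)
  · intro A hA B hB a b ha hb hab
    refine (tvDist_add_smul_le (A η) (A ζ) (B η) (B ζ) ha hb).trans ?_
    have h1 := mul_le_mul_of_nonneg_left hA ha
    have h2 := mul_le_mul_of_nonneg_left hB hb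
    have h3 : a * d + b * d = d := by rw [← add_mul, hab, one_mul]
    linarith

theorem tvDist_voterLaw_le {q : S → S → ℝ} (hq : ∀ x y, x ≠ y → 0 ≤ q x y) {t : ℝ} (ht : 0 ≤ t)
    {d : ℝ} (hd : ∀ η ζ : S → Bool, tvDist (hypercubeLaw t η) (hypercubeLaw t ζ) ≤ d)
    (η ζ : S → Bool) : tvDist (voterLaw q t η) (voterLaw q t ζ) ≤ d := by
  simp only [hypercubeLaw_eq] at hd
  have hlim := tendsto_noise_mul_pow q t
  have h1 : ∀ η : S → Bool, Tendsto (fun n : ℕ => ((noise (Real.exp (-(t / n))) *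
      (1 + (t / (n : ℝ)) • votingGenerator q)) ^ n : Matrix (S → Bool) (S → Bool) ℝ) η) atTop
      (𝓝 (voterLaw q t η)) := fun η =>
    ((continuous_apply η).tendsto _).comp hlim
  refine le_of_tendsto ((continuous_tvDist.tendsto _).comp ((h1 η).prodMk_nhds (h1 ζ))) ?_
  have h2 : ∀ᶠ n : ℕ in atTop,
      t / (n : ℝ) * ∑ x, ∑ y ∈ Finset.univ.erase x, q x y ≤ 1 := by
    have := (tendsto_const_div_atTop_nhds_zero_nat t).mul_const
      (∑ x, ∑ y ∈ Finset.univ.erase x, q x y)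
    rw [zero_mul] at this
    exact this.eventually_le_const one_pos
  filter_upwards [h2, eventually_ge_atTop 1] with n hn hn1
  have hn0 : (n : ℝ) ≠ 0 := by positivity
  have hB := one_add_smul_votingGenerator_mem hq (div_nonneg ht n.cast_nonneg) hn
  have hθ0 : 0 ≤ Real.exp (-(t / n)) := (Real.exp_pos _).le
  have hθ1 : Real.exp (-(t / n)) ≤ 1 :=
    Real.exp_le_one_iff.2 (neg_nonpos.2 (div_nonneg ht n.cast_nonneg))
  have hpow : ∀ k : ℕ, (noise (Real.exp (-(t / n))) *
      (1 + (t / (n : ℝ)) • votingGenerator q)) ^ k ∈ degradedNoise S (Real.exp (-(t / n)) ^ k) := by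
    intro k
    induction k with
    | zero => simpa using one_mem_degradedNoise
    | succ k ih =>
      rw [pow_succ', pow_succ']
      exact noise_mul_mem_degradedNoise hθ0 hθ1 (pow_nonneg hθ0 k) (pow_le_one₀ hθ0 hθ1) hB ih
  have hexp : Real.exp (-(t / n)) ^ n = Real.exp (-t) := by
    rw [← Real.exp_nat_mul]
    congr 1
    field_simp
  have := hpow n
  rw [hexp] at this
  exact tvDist_le_of_mem_degradedNoise hd this η ζ

theorem tvDist_hypercubeLaw_le_iSup (t : ℝ) (η ζ : S → Bool) :
    tvDist (hypercubeLaw t η) (hypercubeLaw t ζ) ≤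
      ⨆ η : (S → Bool) × (S → Bool), tvDist (hypercubeLaw t η.1) (hypercubeLaw t η.2) :=
  le_ciSup (f := fun η : (S → Bool) × (S → Bool) =>
    tvDist (hypercubeLaw t η.1) (hypercubeLaw t η.2)) (Set.finite_range _).bddAbove (η, ζ)

/-- Both laws are invariant, so their distance is at most the noise bound at every time, and noise
of correlation `0` forgets its input. -/
theorem existsUnique_stationary_voterRate {q : S → S → ℝ} (hq : ∀ x y, x ≠ y → 0 ≤ q x y) :
    ∃! μ, IsStationaryDistribution (voterRate q) μ := by
  obtain ⟨μ, hμ⟩ := exists_isStationaryDistribution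
    (r := voterRate q) fun η ζ _ => voterRate_nonneg hq η ζ
  refine ⟨μ, hμ, fun ν hν => ?_⟩
  let D : ℝ → ℝ := fun c => ∑ p : (S → Bool) × (S → Bool), tvDist (noise c p.1) (noise c p.2)
  have hD : ∀ t, 0 ≤ t → tvDist ν μ ≤ D (Real.exp (-t)) := by
    intro t ht
    have h1 : ∀ η ζ : S → Bool, tvDist (hypercubeLaw t η) (hypercubeLaw t ζ) ≤
        D (Real.exp (-t)) := by
      intro η ζ
      simp only [hypercubeLaw_eq, D]
      exact tvDist_le_sum (noise (Real.exp (-t))) η ζ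
    have h2 := tvDist_vecMul_le_of_forall (A := NormedSpace.exp (t • generator (voterRate q)))
      (tvDist_voterLaw_le hq ht h1) hν.1 hν.2.1 hμ.1 hμ.2.1
    rwa [hν.vecMul_exp t, hμ.vecMul_exp t] at h2
  have hcont : Continuous D := by
    simp only [D, tvDist, noise_apply, bitNoise]
    fun_prop
  have hlim : Tendsto (fun t => D (Real.exp (-t))) atTop (𝓝 0) := by
    have h0 : D 0 = 0 := by simp [D, tvDist, noise_apply, bitNoise]
    rw [← h0]
    exact (hcont.tendsto 0).comp Real.tendsto_exp_neg_atTop_nhds_zero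
  exact eq_of_tvDist_le_zero (ge_of_tendsto hlim ((eventually_ge_atTop 0).mono hD))

/-! ### Lower bound by the second moment of the magnetization -/

/-- A lower bound on the total variation distance from first and second moments. -/
theorem sq_le_tvDist_mul {Ω : Type*} [Fintype Ω] {p m f : Ω → ℝ} (hp0 : ∀ x, 0 ≤ p x)
    (hp1 : ∑ x, p x = 1) (hm0 : ∀ x, 0 ≤ m x) (hm1 : ∑ x, m x = 1) {a V : ℝ}
    (hpf : ∑ x, p x * f x = a) (hmf : ∑ x, m x * f x = 0)
    (hpf2 : ∑ x, p x * f x ^ 2 ≤ V + a ^ 2) (hmf2 : ∑ x, m x * f x ^ 2 ≤ V) :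
    a ^ 2 ≤ tvDist p m * (4 * V + a ^ 2) := by
  -- Centring does not affect the difference of means; the midpoint `a / 2` makes the second moments
  -- sum to at most `2 * V + a ^ 2 / 2`.
  have h1 : ∑ x, (p x - m x) * (f x - a / 2) = a := by
    have : ∀ x, (p x - m x) * (f x - a / 2) =
        p x * f x - m x * f x - a / 2 * p x + a / 2 * m x := fun x => by ring
    simp only [this, Finset.sum_add_distrib, Finset.sum_sub_distrib, ← Finset.mul_sum, hpf, hmf,
      hp1, hm1]
    ring
  have h2 : (∑ x, (p x - m x) * (f x - a / 2)) ^ 2 ≤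
      (∑ x, |p x - m x|) * ∑ x, |p x - m x| * (f x - a / 2) ^ 2 := by
    refine Finset.sum_sq_le_sum_mul_sum_of_sq_le_mul _ (fun x _ => abs_nonneg _)
      (fun x _ => mul_nonneg (abs_nonneg _) (sq_nonneg _)) fun x _ => le_of_eq ?_
    rw [mul_pow, ← sq_abs (p x - m x)]
    ring
  have h3 : ∑ x, |p x - m x| * (f x - a / 2) ^ 2 ≤ 2 * V + a ^ 2 / 2 := by
    have h4 : ∑ x, |p x - m x| * (f x - a / 2) ^ 2 ≤ ∑ x, (p x + m x) * (f x - a / 2) ^ 2 := by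
      refine Finset.sum_le_sum fun x _ => mul_le_mul_of_nonneg_right ?_ (sq_nonneg _)
      exact abs_le.2 ⟨by linarith [hp0 x, hm0 x], by linarith [hp0 x, hm0 x]⟩
    have h5 : ∀ x, (p x + m x) * (f x - a / 2) ^ 2 = p x * f x ^ 2 + m x * f x ^ 2
        - a * (p x * f x) - a * (m x * f x) + a ^ 2 / 4 * p x + a ^ 2 / 4 * m x := fun x => by ring
    simp only [h5, Finset.sum_add_distrib, Finset.sum_sub_distrib, ← Finset.mul_sum, hpf, hmf,
      hp1, hm1] at h4
    linarith
  have h6 : 0 ≤ ∑ x, |p x - m x| := Finset.sum_nonneg fun x _ => abs_nonneg _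
  have h7 := mul_le_mul_of_nonneg_left h3 h6
  rw [h1] at h2
  simp only [tvDist]
  linarith

/-- The magnetization of a configuration weighted by `π`. -/
def magnetization (π : S → ℝ) (η : S → Bool) : ℝ := ∑ x, π x * spin (η x)

omit [DecidableEq S] in
theorem magnetization_true {π : S → ℝ} (hπ : ∑ x, π x = 1) :
    magnetization π (fun _ => true) = 1 := by
  simp [magnetization, hπ]

theorem magnetization_flip (π : S → ℝ) (η : S → Bool) (x : S) :
    magnetization π (flip η x) = magnetization π η - 2 * (π x * spin (η x)) := by
  simp only [magnetization]
  rw [← Finset.add_sum_erase _ _ (Finset.mem_univ x),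
    ← Finset.add_sum_erase _ (fun y => π y * spin (η y)) (Finset.mem_univ x)]
  have h1 : ∑ y ∈ Finset.univ.erase x, π y * spin (flip η x y) =
      ∑ y ∈ Finset.univ.erase x, π y * spin (η y) :=
    Finset.sum_congr rfl fun y hy => by
      rw [flip, Function.update_of_ne (Finset.ne_of_mem_erase hy)]
  have h2 : spin (flip η x x) = -spin (η x) := by
    simp only [flip, Function.update_self]
    cases η x <;> simp
  rw [h1, h2]
  ring

theorem flipRate_mul_spin (q : S → S → ℝ) (η : S → Bool) (x : S) :
    flipRate q η x * (-2 * spin (η x)) =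
      -spin (η x) + (generator q *ᵥ fun y => spin (η y)) x := by
  rw [generator_mulVec, ← Finset.add_sum_erase _ _ (Finset.mem_univ x), flipRate, add_mul,
    Finset.sum_mul, sub_self, mul_zero, zero_add]
  congr 1
  · ring
  · refine Finset.sum_congr rfl fun y _ => ?_
    cases η x <;> cases η y <;> norm_num [spin]

/-- Rerandomization contracts each spin at rate `1`; the voting drift is `generator q` applied to
the spins, and its `π`-average vanishes. -/
theorem generator_mulVec_magnetization {q : S → S → ℝ} {π : S → ℝ}
    (hπ : IsStationaryDistribution q π) :
    generator (voterRate q) *ᵥ magnetization π = -magnetization π := by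
  ext η
  rw [generator_voterRate_mulVec]
  have h : ∀ x, flipRate q η x * (magnetization π (flip η x) - magnetization π η) =
      π x * (generator q *ᵥ fun y => spin (η y)) x - π x * spin (η x) := by
    intro x
    rw [magnetization_flip]
    linear_combination π x * flipRate_mul_spin q η x
  simp only [h, Finset.sum_sub_distrib, hπ.sum_mul_generator_mulVec]
  simp [magnetization]

theorem sum_erase_le_qmax (q : S → S → ℝ) (x : S) :
    ∑ y ∈ Finset.univ.erase x, q x y ≤ qmax q :=
  le_ciSup (f := fun x => ∑ y ∈ Finset.univ.erase x, q x y) (Set.finite_range _).bddAbove x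

theorem qmax_nonneg {q : S → S → ℝ} (hq : ∀ x y, x ≠ y → 0 ≤ q x y) : 0 ≤ qmax q :=
  Real.iSup_nonneg fun x => Finset.sum_nonneg fun y hy =>
    hq x y (Finset.ne_of_mem_erase hy).symm

theorem flipRate_le {q : S → S → ℝ} (hq : ∀ x y, x ≠ y → 0 ≤ q x y) (η : S → Bool) (x : S) :
    flipRate q η x ≤ 1 / 2 + qmax q := by
  refine add_le_add le_rfl ((Finset.sum_le_sum fun y hy => ?_).trans (sum_erase_le_qmax q x))
  split_ifs
  exacts [hq x y (Finset.ne_of_mem_erase hy).symm, le_rfl]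

/-- Write `A ^ 2 - B ^ 2 = 2 * B * (A - B) + (A - B) ^ 2`: the first term is the drift, and a flip
at `x` makes the second `4 * π x ^ 2`. -/
theorem generator_mulVec_magnetization_sq_le {q : S → S → ℝ} (hq : ∀ x y, x ≠ y → 0 ≤ q x y)
    {π : S → ℝ} (hπ : IsStationaryDistribution q π) (η : S → Bool) :
    (generator (voterRate q) *ᵥ fun η => magnetization π η ^ 2) η ≤
      -2 * magnetization π η ^ 2 + 2 * ((1 + 2 * qmax q) * ∑ x, π x ^ 2) := by
  have h1 := congrFun (generator_mulVec_magnetization hπ) η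
  rw [generator_voterRate_mulVec] at h1 ⊢
  have h2 : ∀ x, flipRate q η x * (magnetization π (flip η x) ^ 2 - magnetization π η ^ 2) =
      2 * magnetization π η * (flipRate q η x * (magnetization π (flip η x) - magnetization π η))
        + flipRate q η x * (4 * π x ^ 2) := by
    intro x
    have hs : spin (η x) ^ 2 = 1 := by cases η x <;> simp
    rw [magnetization_flip]
    linear_combination (flipRate q η x * 4 * π x ^ 2) * hs
  simp only [h2, Finset.sum_add_distrib, ← Finset.mul_sum, h1, Pi.neg_apply]
  have h3 : ∑ x, flipRate q η x * (4 * π x ^ 2) ≤ ∑ x, (1 / 2 + qmax q) * (4 * π x ^ 2) :=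
    Finset.sum_le_sum fun x _ => mul_le_mul_of_nonneg_right (flipRate_le hq η x) (by positivity)
  rw [← Finset.mul_sum, ← Finset.mul_sum] at h3
  linarith

theorem exp_neg_two_mul_le_tvDist {q : S → S → ℝ} (hq : ∀ x y, x ≠ y → 0 ≤ q x y)
    {π : S → ℝ} (hπ : IsStationaryDistribution q π) {μ : (S → Bool) → ℝ}
    (hμ : IsStationaryDistribution (voterRate q) μ) {t : ℝ} (ht : 0 ≤ t) :
    Real.exp (-(2 * t)) ≤ tvDist (voterLaw q t (fun _ => true)) μ *
      (4 * ((1 + 2 * qmax q) * ∑ x, π x ^ 2) + Real.exp (-(2 * t))) := by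
  set V := (1 + 2 * qmax q) * ∑ x, π x ^ 2 with hV
  have hV0 : 0 ≤ V := mul_nonneg (by linarith [qmax_nonneg hq])
    (Finset.sum_nonneg fun x _ => sq_nonneg _)
  have hr : ∀ η ζ : S → Bool, η ≠ ζ → 0 ≤ voterRate q η ζ := fun η ζ _ => voterRate_nonneg hq η ζ
  have hP := exp_smul_generator_mem hr ht
  have hsq : (Real.exp (-t)) ^ 2 = Real.exp (-(2 * t)) := by
    rw [← Real.exp_nat_mul]; congr 1; push_cast; ring
  have hmean : ∑ η, voterLaw q t (fun _ => true) η * magnetization π η = Real.exp (-t) := by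
    have h := congrFun (exp_smul_generator_mulVec_eq hr ht (c := 1) (w := magnetization π) (by
      rw [generator_mulVec_magnetization hπ, neg_one_smul])) fun _ => true
    rw [Pi.smul_apply, magnetization_true hπ.2.1, smul_eq_mul, mul_one, neg_one_mul] at h
    exact h
  have hmean' : ∑ η, μ η * magnetization π η = 0 := by
    have h := hμ.sum_mul_generator_mulVec (magnetization π)
    rw [generator_mulVec_magnetization hπ] at h
    simpa using h
  have hsecond : ∑ η, voterLaw q t (fun _ => true) η * magnetization π η ^ 2 ≤
      V + Real.exp (-t) ^ 2 := by
    -- Subtracting `V` absorbs the constant term, leaving pure decay at rate `2` from the initial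
    -- value `1 - V`.
    have hw : generator (voterRate q) *ᵥ (fun η => magnetization π η ^ 2 - V) ≤
        -(2 : ℝ) • fun η => magnetization π η ^ 2 - V := by
      intro η
      have h := generator_mulVec_magnetization_sq_le hq hπ η
      rw [generator_mulVec] at h ⊢
      simp only [sub_sub_sub_cancel_right, Pi.smul_apply, smul_eq_mul]
      linarith
    have h := exp_smul_generator_mulVec_le hr ht hw fun _ => true
    have h1 : (NormedSpace.exp (t • generator (voterRate q)) *ᵥ
        (fun η => magnetization π η ^ 2 - V)) (fun _ => true) =
        ∑ η, voterLaw q t (fun _ => true) η * magnetization π η ^ 2 - V := by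
      have h2 : ∑ η, voterLaw q t (fun _ => true) η * V = V := by
        rw [← Finset.sum_mul]
        exact (congrArg (· * V) (sum_row_of_mem_rowStochastic hP fun _ => true)).trans (one_mul V)
      conv_rhs => rw [← h2]
      rw [← Finset.sum_sub_distrib]
      exact Finset.sum_congr rfl fun η _ => mul_sub _ _ _
    rw [h1, Pi.smul_apply, magnetization_true hπ.2.1, smul_eq_mul] at h
    have h3 : Real.exp (-2 * t) = Real.exp (-t) ^ 2 := by rw [hsq, neg_mul]
    rw [h3] at h
    nlinarith [sq_nonneg (Real.exp (-t))]
  have hsecond' : ∑ η, μ η * magnetization π η ^ 2 ≤ V := by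
    have h := hμ.sum_mul_generator_mulVec fun η => magnetization π η ^ 2
    have h1 : ∑ η, μ η * (generator (voterRate q) *ᵥ fun η => magnetization π η ^ 2) η ≤
        ∑ η, μ η * (-2 * magnetization π η ^ 2 + 2 * V) :=
      Finset.sum_le_sum fun η _ => mul_le_mul_of_nonneg_left
        (generator_mulVec_magnetization_sq_le hq hπ η) (hμ.1 η)
    have h2 : ∑ η, μ η * (-2 * magnetization π η ^ 2 + 2 * V) =
        -2 * ∑ η, μ η * magnetization π η ^ 2 + 2 * V := by
      simp only [mul_add, Finset.sum_add_distrib, ← Finset.sum_mul, hμ.2.1, one_mul,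
        mul_left_comm _ (-2 : ℝ), ← Finset.mul_sum]
    linarith
  have h := sq_le_tvDist_mul (fun η => nonneg_of_mem_rowStochastic hP)
    (sum_row_of_mem_rowStochastic hP fun _ => true) hμ.1 hμ.2.1 hmean hmean' hsecond hsecond'
  rwa [hsq] at h

omit [DecidableEq S] in
theorem exists_ratio_eq {π : S → ℝ} (h0 : ∀ x, 0 ≤ π x) (h1 : ∑ x, π x = 1)
    (hr : ratio π ≠ ⊤) : ∃ R : ℝ, 0 ≤ R ∧ ratio π = ENNReal.ofReal R ∧
      ∑ x, π x ^ 2 ≤ R ^ 2 / Fintype.card S := by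
  have hne : Nonempty S := by
    by_contra h
    rw [not_nonempty_iff] at h
    simp at h1
  obtain ⟨x₁, hx₁⟩ := exists_eq_ciSup_of_finite (f := fun x => ENNReal.ofReal (π x))
  obtain ⟨x₀, hx₀⟩ := exists_eq_ciInf_of_finite (f := fun x => ENNReal.ofReal (π x))
  have hmax : ∀ x, π x ≤ π x₁ := fun x => (ENNReal.ofReal_le_ofReal_iff (h0 x₁)).1
    ((le_iSup (fun x => ENNReal.ofReal (π x)) x).trans_eq hx₁.symm)
  have hmin : ∀ x, π x₀ ≤ π x := fun x => (ENNReal.ofReal_le_ofReal_iff (h0 x)).1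
    (hx₀.trans_le (iInf_le (fun x => ENNReal.ofReal (π x)) x))
  have hx₁0 : 0 < π x₁ := by
    by_contra h
    have : ∑ x, π x ≤ 0 := Finset.sum_nonpos fun x _ => (hmax x).trans (not_lt.1 h)
    linarith
  have hx₀0 : 0 < π x₀ := by
    refine lt_of_le_of_ne (h0 x₀) fun h => hr ?_
    rw [ratio, ← hx₀, ← hx₁, ← h, ENNReal.ofReal_zero, ENNReal.div_zero]
    simpa using hx₁0
  have hcard : (0 : ℝ) < Fintype.card S := by exact_mod_cast Fintype.card_pos
  refine ⟨π x₁ / π x₀, by positivity, ?_, ?_⟩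
  · rw [ENNReal.ofReal_div_of_pos hx₀0, ratio, ← hx₀, ← hx₁]
  · have hle : Fintype.card S * π x₀ ≤ 1 := by
      rw [← h1, ← nsmul_eq_mul, ← Finset.card_univ]
      exact Finset.card_nsmul_le_sum _ _ _ fun x _ => hmin x
    have h2 : ∑ x, π x ^ 2 ≤ Fintype.card S * π x₁ ^ 2 := by
      rw [← nsmul_eq_mul, ← Finset.card_univ]
      exact Finset.sum_le_card_nsmul _ _ _ fun x _ => pow_le_pow_left₀ (h0 x) (hmax x) 2
    refine h2.trans ?_
    rw [div_pow, div_div, le_div_iff₀ (by positivity)]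
    have h3 : (Fintype.card S * π x₀) ^ 2 ≤ 1 := pow_le_one₀ (by positivity) hle
    nlinarith [mul_le_mul_of_nonneg_left h3 (sq_nonneg (π x₁))]

theorem ofReal_le_tvDist_mul {q : S → S → ℝ} (hq : ∀ x y, x ≠ y → 0 ≤ q x y)
    {π : S → ℝ} (hπ : IsStationaryDistribution q π) (hr : ratio π ≠ ⊤) {μ : (S → Bool) → ℝ}
    (hμ : IsStationaryDistribution (voterRate q) μ) {α t : ℝ} (ht : 0 ≤ t)
    (hα : t = (1 / 2) * Real.log (Fintype.card S) - α) :
    ENNReal.ofReal (0.7 * Real.exp (2 * α)) ≤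
      ENNReal.ofReal (tvDist (voterLaw q t (fun _ => true)) μ) *
        (16 * (1 + ENNReal.ofReal (qmax q)) ^ 2 * ratio π ^ 2 +
          ENNReal.ofReal (0.7 * Real.exp (2 * α))) := by
  obtain ⟨R, hR0, hR, hsum⟩ := exists_ratio_eq hπ.1 hπ.2.1 hr
  have hne : Nonempty S := by
    by_contra h
    rw [not_nonempty_iff] at h
    simpa using hπ.2.1
  have hcard : (0 : ℝ) < Fintype.card S := by exact_mod_cast Fintype.card_pos
  have hQ := qmax_nonneg hq
  have hT := tvDist_nonneg (voterLaw q t (fun _ => true)) μ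
  have key := exp_neg_two_mul_le_tvDist hq hπ hμ ht
  set T := tvDist (voterLaw q t (fun _ => true)) μ
  set Q := qmax q
  have hexp : Real.exp (-(2 * t)) = Real.exp (2 * α) / Fintype.card S := by
    have : -(2 * t) = 2 * α - Real.log (Fintype.card S) := by rw [hα]; ring
    rw [this, Real.exp_sub, Real.exp_log hcard]
  have hreal : 0.7 * Real.exp (2 * α) ≤
      T * (16 * (1 + Q) ^ 2 * R ^ 2 + 0.7 * Real.exp (2 * α)) := by
    rw [hexp] at key
    have h1 : (4 * ((1 + 2 * Q) * ∑ x, π x ^ 2) + Real.exp (2 * α) / Fintype.card S) ≤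
        (4 * ((1 + 2 * Q) * (R ^ 2 / Fintype.card S)) + Real.exp (2 * α) / Fintype.card S) := by
      have := mul_le_mul_of_nonneg_left hsum (by linarith : 0 ≤ 1 + 2 * Q)
      linarith
    have h2 := key.trans (mul_le_mul_of_nonneg_left h1 hT)
    have h3 : T * (4 * ((1 + 2 * Q) * (R ^ 2 / Fintype.card S)) +
        Real.exp (2 * α) / Fintype.card S) =
        T * (4 * (1 + 2 * Q) * R ^ 2 + Real.exp (2 * α)) / Fintype.card S := by
      field_simp
    rw [h3, div_le_div_iff_of_pos_right hcard] at h2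
    -- The factor `1 / |S|` has cancelled; scaling `h2` by `0.7` leaves ample room below `16 * (1 +
    -- Q) ^ 2`.
    have h4 : 0 ≤ T * ((16 * (1 + Q) ^ 2 - 0.7 * (4 * (1 + 2 * Q))) * R ^ 2) :=
      mul_nonneg hT (mul_nonneg (by nlinarith) (sq_nonneg R))
    nlinarith
  rw [hR]
  refine (ENNReal.ofReal_le_ofReal hreal).trans_eq ?_
  rw [ENNReal.ofReal_mul hT, ENNReal.ofReal_add (by positivity) (by positivity),
    ENNReal.ofReal_mul (by positivity), ENNReal.ofReal_mul (by positivity),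
    ENNReal.ofReal_pow (by positivity), ENNReal.ofReal_pow hR0, ENNReal.ofReal_add one_pos.le hQ,
    ENNReal.ofReal_one, ENNReal.ofReal_ofNat]

theorem div_le_tvDist {q : S → S → ℝ} (hq : ∀ x y, x ≠ y → 0 ≤ q x y) {μ : (S → Bool) → ℝ}
    (hμ : IsStationaryDistribution (voterRate q) μ) {α t : ℝ} (ht : 0 ≤ t)
    (hα : t = (1 / 2) * Real.log (Fintype.card S) - α) :
    ENNReal.ofReal (0.7 * Real.exp (2 * α)) /
        (16 * (1 + ENNReal.ofReal (qmax q)) ^ 2 * rho q ^ 2 +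
          ENNReal.ofReal (0.7 * Real.exp (2 * α))) ≤
      ENNReal.ofReal (tvDist (voterLaw q t (fun _ => true)) μ) := by
  have hA : 16 * (1 + ENNReal.ofReal (qmax q)) ^ 2 ≠ ⊤ := by finiteness
  rcases eq_or_ne (rho q) ⊤ with h | h
  · rw [h]
    simp
  refine ENNReal.div_le_of_le_mul ?_
  have hcont : Continuous fun r : ENNReal =>
      ENNReal.ofReal (tvDist (voterLaw q t (fun _ => true)) μ) *
        (16 * (1 + ENNReal.ofReal (qmax q)) ^ 2 * r ^ 2 +
          ENNReal.ofReal (0.7 * Real.exp (2 * α))) :=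
    (ENNReal.continuous_const_mul ENNReal.ofReal_ne_top).comp
      (((ENNReal.continuous_const_mul hA).comp (ENNReal.continuous_pow 2)).add continuous_const)
  -- Attainment of the infimum is not needed: the bound holds for every `r > rho q`, and the right
  -- side is continuous in `r`.
  have hlt : rho q < ⊤ := h.lt_top
  have : (𝓝[>] rho q).NeBot := nhdsGT_neBot_of_exists_gt ⟨⊤, hlt⟩
  refine ge_of_tendsto ((hcont.tendsto (rho q)).mono_left
    (nhdsWithin_le_nhds (s := Set.Ioi (rho q)))) ?_
  filter_upwards [self_mem_nhdsWithin] with r hr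
  obtain ⟨⟨π, hπ⟩, hπr⟩ := iInf_lt_iff.1 (show rho q < r from hr)
  refine (ofReal_le_tvDist_mul hq hπ (hπr.trans_le le_top).ne hμ ht hα).trans ?_
  gcongr

end

end NoisyVoter

theorem theorem3 {S : Type*} [Fintype S] [DecidableEq S] (hS : 2 ≤ Fintype.card S)
    (q : S → S → ℝ) (hq : ∀ x y, x ≠ y → 0 ≤ q x y) :
    (∃! μ : (S → Bool) → ℝ,
      NoisyVoter.IsStationaryDistribution (NoisyVoter.voterRate q) μ) ∧
    (∀ μ : (S → Bool) → ℝ,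
      NoisyVoter.IsStationaryDistribution (NoisyVoter.voterRate q) μ →
      ∀ α t : ℝ, 1 ≤ α → t = (1 / 2) * Real.log (Fintype.card S) - α → 1 ≤ t →
        ENNReal.ofReal
            (NoisyVoter.tvDist (NoisyVoter.voterLaw q t (fun _ => true)) μ) ≥
          ENNReal.ofReal (0.7 * Real.exp (2 * α)) /
            (16 * (1 + ENNReal.ofReal (NoisyVoter.qmax q)) ^ 2 * NoisyVoter.rho q ^ 2 +
              ENNReal.ofReal (0.7 * Real.exp (2 * α)))) ∧
    (∀ t : ℝ, 0 ≤ t →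
      (⨆ η : (S → Bool) × (S → Bool),
          NoisyVoter.tvDist (NoisyVoter.voterLaw q t η.1) (NoisyVoter.voterLaw q t η.2)) ≤
        ⨆ η : (S → Bool) × (S → Bool),
          NoisyVoter.tvDist (NoisyVoter.hypercubeLaw t η.1)
            (NoisyVoter.hypercubeLaw t η.2)) := by
  refine ⟨NoisyVoter.existsUnique_stationary_voterRate hq, fun μ hμ α t _ hα ht =>
    NoisyVoter.div_le_tvDist hq hμ (zero_le_one.trans ht) hα, fun t ht => ciSup_le fun η => ?_⟩
  exact NoisyVoter.tvDist_voterLaw_le hq ht (NoisyVoter.tvDist_hypercubeLaw_le_iSup t) η.1 η.2
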